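/- Let $\mathcal{A}$ be a unital exact $C^*$-algebra, $\theta\in\mathrm{Aut}(\mathcal{A})$ and $a=a^*\in\mathcal{A}$. Let $u$ be the canonical unitary implementing $\theta$ in the crossed product $\mathcal{A}\rtimes_\theta\mathbb{Z}$, and identify $a$ with its image under the natural inclusion $\mathcal{A}\hookrightarrow\mathcal{A}\rtimes_\theta\mathbb{Z}$. Then $$P_\theta(a)=P_{\mathrm{Ad}\,u}(a).$$ Here $\mathcal{A}\rtimes_\theta\mathbb{Z}$ is realized, from any faithful unital representation $\pi_0:\mathcal{A}\to\mathcal{B}(\mathcal{H}_0)$, as the $C^*$-algebra of operators on $\ell^2(\mathbb{Z},\mathcal{H}_0)$ generated by the operators $(\tilde\pi(x)\xi)(n)=\pi_0(\theta^{-n}(x))\xi(n)$, $x\in\mathcal{A}$, and the translation $(u\xi)(n)=\xi(n-1)$; the natural inclusion is $x\mapsto\tilde\pi(x)$, and $\mathrm{Ad}\,u(y)=uyu^*$. For a unital $C^*$-algebra $\mathcal{C}$, an automorphism $\alpha$ of $\mathcal{C}$ and $c=c^*\in\mathcal{C}$, the approximation pressure $P_\alpha(c)\in[-\infty,+\infty]$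 is defined as follows. Fix a faithful unital $*$-representation $\pi:\mathcal{C}\to\mathcal{B}(\mathcal{H})$. For a subset $S\subset\mathcal{C}$ and $\delta>0$ let $\mathrm{CPA}(\pi,S,\delta)$ be the set of triples $(\phi,\psi,\mathcal{B})$ in which $\mathcal{B}$ is a finite-dimensional $C^*$-algebra and $\phi:\mathcal{C}\to\mathcal{B}$, $\psi:\mathcal{B}\to\mathcal{B}(\mathcal{H})$ are unital completely positive maps with $\|\psi(\phi(x))-\pi(x)\|<\delta$ for all $x\in S$. For a finite set $\Omega\subset\mathcal{C}$ put $\Omega^{(n)}=\bigcup_{j=0}^{n-1}\alpha^j(\Omega)$, $c^{(n)}=\sum_{j=0}^{n-1}\alpha^j(c)$ and $$Z_{\alpha,n}(\pi,c,\Omega,\delta)=\inf\{\mathrm{Tr}\,e^{\phi(c^{(n)})} : (\phi,\psi,\mathcal{B})\in\mathrm{CPA}(\pi,\Omega^{(n)},\delta)\},$$ where $\mathrm{Tr}$ is the trace of $\mathcal{B}$ taking the value $1$ on every minimal projection. Then $$P_\alpha(c)=\sup_{\Omega}\,\sup_{\delta>0}\,\limsup_{n\to\infty}\frac1n\log Z_{\alpha,n}(\pi,c,\Omega,\delta).$$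 The equality holds for every choice of $\pi_0$ and of the faithful unital representations of $\mathcal{A}$ and of $\mathcal{A}\rtimes_\theta\mathbb{Z}$ used to compute the two pressures. -/

import Mathlib

open scoped TensorProduct InnerProductSpace ENNReal

noncomputable section

namespace CStarPressure

universe u v w

/-! ## The minimal tensor product and exact C*-algebras -/

/-- A *-representation of a C*-algebra on a Hilbert space. -/
structure Rep (A : Type u) [NonUnitalCStarAlgebra A] : Type (u + 1) where
  carrier : Type u
  [normed : NormedAddCommGroup carrier]
  [inner : InnerProductSpace ℂ carrier]
  [complete : CompleteSpace carrier]
  hom : A →⋆ₙₐ[ℂ] (carrier →L[ℂ] carrier)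

attribute [instance] Rep.normed Rep.inner Rep.complete

section MinTensor

variable {A B C : Type u} [NonUnitalCStarAlgebra A] [NonUnitalCStarAlgebra B]
  [NonUnitalCStarAlgebra C]

/-- The representation `π ⊗ ρ : a ⊗ b ↦ π a ⊗ ρ b` of the algebraic tensor product `A ⊗ B` on
the algebraic tensor product of the two Hilbert spaces with its inner product norm. (The norm of
a bounded operator there is the norm of its extension to the Hilbert space tensor product.) -/
def tensorRep (π : Rep A) (ρ : Rep B) :
    A ⊗[ℂ] B →ₗ[ℂ] (π.carrier ⊗[ℂ] ρ.carrier →L[ℂ] π.carrier ⊗[ℂ] ρ.carrier) :=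
  TensorProduct.lift (LinearMap.mk₂ ℂ (fun a b => TensorProduct.mapL (π.hom a) (ρ.hom b))
    (fun a a' b => by rw [map_add, TensorProduct.mapL_add_left])
    (fun c a b => by rw [map_smul, TensorProduct.mapL_smul_left])
    (fun a b b' => by rw [map_add, TensorProduct.mapL_add_right])
    (fun c a b => by rw [map_smul, TensorProduct.mapL_smul_right]))

theorem tensorRep_tmul (π : Rep A) (ρ : Rep B) (a : A) (b : B) :
    tensorRep π ρ (a ⊗ₜ[ℂ] b) = TensorProduct.mapL (π.hom a) (ρ.hom b) := rfl

/-- The minimal (spatial) C*-norm on the algebraic tensor product: the supremum of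
`‖(π ⊗ ρ) x‖` over all pairs of *-representations. -/
def minNorm (x : A ⊗[ℂ] B) : ℝ := ⨆ p : Rep A × Rep B, ‖tensorRep p.1 p.2 x‖

theorem minNorm_bddAbove (x : A ⊗[ℂ] B) :
    BddAbove (Set.range fun p : Rep A × Rep B => ‖tensorRep p.1 p.2 x‖) := by
  induction x using TensorProduct.induction_on with
  | zero =>
    refine ⟨0, ?_⟩
    rintro _ ⟨p, rfl⟩
    simp only [map_zero]
    exact ContinuousLinearMap.opNorm_zero.le
  | tmul a b =>
    refine ⟨‖a‖ * ‖b‖, ?_⟩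
    rintro _ ⟨p, rfl⟩
    simp only [tensorRep_tmul]
    refine (TensorProduct.norm_mapL_le _ _).trans ?_
    gcongr
    · exact NonUnitalStarAlgHom.norm_apply_le p.1.hom a
    · exact NonUnitalStarAlgHom.norm_apply_le p.2.hom b
  | add x y hx hy =>
    obtain ⟨c, hc⟩ := hx
    obtain ⟨d, hd⟩ := hy
    refine ⟨c + d, ?_⟩
    rintro _ ⟨p, rfl⟩
    simp only [map_add]
    exact (ContinuousLinearMap.opNorm_add_le _ _).trans
      (add_le_add (hc ⟨p, rfl⟩) (hd ⟨p, rfl⟩))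

theorem minNorm_nonneg (x : A ⊗[ℂ] B) : 0 ≤ minNorm x :=
  Real.iSup_nonneg fun _ => ContinuousLinearMap.opNorm_nonneg _

theorem minNorm_zero : minNorm (0 : A ⊗[ℂ] B) = 0 := by
  refine le_antisymm (Real.iSup_le (fun p => ?_) le_rfl) (minNorm_nonneg _)
  rw [map_zero]
  exact ContinuousLinearMap.opNorm_zero.le

theorem minNorm_add_le (x y : A ⊗[ℂ] B) : minNorm (x + y) ≤ minNorm x + minNorm y := by
  refine Real.iSup_le (fun p => ?_) (add_nonneg (minNorm_nonneg x) (minNorm_nonneg y))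
  rw [map_add]
  exact (ContinuousLinearMap.opNorm_add_le _ _).trans
    (add_le_add (le_ciSup (minNorm_bddAbove x) p) (le_ciSup (minNorm_bddAbove y) p))

theorem minNorm_neg (x : A ⊗[ℂ] B) : minNorm (-x) = minNorm x := by
  refine congrArg iSup (funext fun p => ?_)
  rw [map_neg]
  exact ContinuousLinearMap.opNorm_neg _

/-- The algebraic tensor product equipped with the minimal C*-norm. -/
def AlgMinTensor (A B : Type u) [NonUnitalCStarAlgebra A] [NonUnitalCStarAlgebra B] : Type u :=
  A ⊗[ℂ] B

instance : AddCommGroup (AlgMinTensor A B) := inferInstanceAs (AddCommGroup (A ⊗[ℂ] B))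

instance : SeminormedAddCommGroup (AlgMinTensor A B) :=
  AddGroupSeminorm.toSeminormedAddCommGroup
    { toFun := fun x : AlgMinTensor A B => minNorm (A := A) (B := B) x
      map_zero' := minNorm_zero
      add_le' := minNorm_add_le
      neg' := minNorm_neg }

/-- The minimal tensor product `A ⊗_min B` (its underlying normed group). -/
abbrev MinTensor (A B : Type u) [NonUnitalCStarAlgebra A] [NonUnitalCStarAlgebra B] : Type u :=
  UniformSpace.Completion (AlgMinTensor A B)

theorem minNorm_lTensor_le (f : B →⋆ₙₐ[ℂ] C) (x : A ⊗[ℂ] B) :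
    minNorm (LinearMap.lTensor A (f : B →ₗ[ℂ] C) x) ≤ minNorm x := by
  refine Real.iSup_le (fun p => ?_) (minNorm_nonneg x)
  let q : Rep A × Rep B := (p.1, { carrier := p.2.carrier, hom := p.2.hom.comp f })
  have key : tensorRep p.1 p.2 (LinearMap.lTensor A (f : B →ₗ[ℂ] C) x)
      = tensorRep q.1 q.2 x := by
    induction x using TensorProduct.induction_on with
    | zero => simp
    | tmul a b => rfl
    | add x y hx hy => rw [map_add, map_add, map_add, hx, hy]
  rw [key]
  exact le_ciSup (minNorm_bddAbove x) q

/-- The map `id ⊗ f : A ⊗_min B → A ⊗_min C` induced by a *-homomorphism `f : B → C`. -/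
def minTensorMap (A : Type u) [NonUnitalCStarAlgebra A] (f : B →⋆ₙₐ[ℂ] C) :
    NormedAddGroupHom (MinTensor A B) (MinTensor A C) :=
  NormedAddGroupHom.completion
    (AddMonoidHom.mkNormedAddGroupHom
      ((LinearMap.lTensor A (f : B →ₗ[ℂ] C)).toAddMonoidHom :
        AlgMinTensor A B →+ AlgMinTensor A C) 1
      (fun x => by rw [one_mul]; exact minNorm_lTensor_le f x))

end MinTensor

/-- A C*-algebra `A` is exact if `A ⊗_min ·` sends every short exact sequence
`0 → J → B → C → 0` of C*-algebras to a short exact sequence. -/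
def IsExact (A : Type u) [NonUnitalCStarAlgebra A] : Prop :=
  ∀ (J B C : Type u) [NonUnitalCStarAlgebra J] [NonUnitalCStarAlgebra B]
    [NonUnitalCStarAlgebra C] (i : J →⋆ₙₐ[ℂ] B) (q : B →⋆ₙₐ[ℂ] C),
    Function.Injective i → Function.Exact i q → Function.Surjective q →
      Function.Injective (minTensorMap A i) ∧
      Function.Exact (minTensorMap A i) (minTensorMap A q) ∧
      Function.Surjective (minTensorMap A q)

/-! ## The approximation pressure -/

/-- Unital completely positive maps. Complete positivity is Mathlib's, for the canonical order of
the C*-algebras. -/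
def IsUCP {A : Type u} {B : Type v} [CStarAlgebra A] [CStarAlgebra B] (φ : A →ₗ[ℂ] B) : Prop :=
  letI := CStarAlgebra.spectralOrder A
  letI := CStarAlgebra.spectralOrder B
  letI := CStarAlgebra.spectralOrderedRing A
  letI := CStarAlgebra.spectralOrderedRing B
  φ 1 = 1 ∧ ∃ Φ : CompletelyPositiveMap A B, Φ.toLinearMap = φ

/-- A minimal projection: a nonzero projection dominating no projection but `0` and itself. -/
def IsMinimalProjection {B : Type u} [CStarAlgebra B] (e : B) : Prop :=
  IsStarProjection e ∧ e ≠ 0 ∧ ∀ f : B, IsStarProjection f → e * f = f → f = 0 ∨ f = e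

/-- `τ` is the trace `Tr` of the finite-dimensional C*-algebra `B`: the (unique) tracial linear
functional with value `1` on every minimal projection. -/
def IsCanonicalTrace {B : Type u} [CStarAlgebra B] (τ : B →ₗ[ℂ] ℂ) : Prop :=
  (∀ x y, τ (x * y) = τ (y * x)) ∧ ∀ e, IsMinimalProjection e → τ e = 1

section Pressure

variable {A : Type u} [CStarAlgebra A] {H : Type v} [NormedAddCommGroup H]
  [InnerProductSpace ℂ H] [CompleteSpace H]

/-- The collection `CPA(π, S, δ)` of completely positive approximations `(φ, ψ, B)`, together
with the canonical trace of `B`. Every finite-dimensional C*-algebra is isomorphic to one in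
`Type`. -/
structure CPA (π : A →⋆ₐ[ℂ] (H →L[ℂ] H)) (S : Set A) (δ : ℝ) where
  B : Type
  [cstar : CStarAlgebra B]
  [finDim : FiniteDimensional ℂ B]
  φ : A →ₗ[ℂ] B
  ψ : B →ₗ[ℂ] (H →L[ℂ] H)
  Tr : B →ₗ[ℂ] ℂ
  isUCP_φ : IsUCP φ
  isUCP_ψ : IsUCP ψ
  isCanonicalTrace : IsCanonicalTrace Tr
  approx : ∀ x ∈ S, ‖ψ (φ x) - π x‖ < δ

attribute [instance] CPA.cstar CPA.finDim

/-- `Ω ∪ θ(Ω) ∪ ⋯ ∪ θ^{n-1}(Ω)`. -/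
def orbitSet (θ : A → A) (Ω : Set A) (n : ℕ) : Set A :=
  ⋃ j ∈ Finset.range n, θ^[j] '' Ω

/-- `a + θ(a) + ⋯ + θ^{n-1}(a)`. -/
def orbitSum (θ : A → A) (a : A) (n : ℕ) : A := ∑ j ∈ Finset.range n, θ^[j] a

/-- The partition function: the infimum of `Tr e^{φ(a^{(n)})}` (a nonnegative real number when
`a` is self-adjoint and `θ` is *-preserving) over `CPA(π, Ω^{(n)}, δ)`. -/
def partitionFunction (π : A →⋆ₐ[ℂ] (H →L[ℂ] H)) (θ : A → A) (a : A) (Ω : Set A) (δ : ℝ)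
    (n : ℕ) : ℝ≥0∞ :=
  ⨅ c : CPA π (orbitSet θ Ω n) δ,
    ENNReal.ofReal (c.Tr (NormedSpace.exp (c.φ (orbitSum θ a n)))).re

/-- `P_θ(π, a, Ω, δ) = limsup_n (1/n) log Z_{θ,n}(π, a, Ω, δ)`. -/
def localPressure (π : A →⋆ₐ[ℂ] (H →L[ℂ] H)) (θ : A → A) (a : A) (Ω : Set A) (δ : ℝ) : EReal :=
  Filter.limsup (fun n : ℕ => ENNReal.log (partitionFunction π θ a Ω δ n) / (n : EReal))
    Filter.atTop

/-- The approximation pressure `P_θ(π, a)`, as an extended real number: the supremum of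
`P_θ(π, a, Ω, δ)` over all finite subsets `Ω` and all `δ > 0`. -/
def pressure (π : A →⋆ₐ[ℂ] (H →L[ℂ] H)) (θ : A → A) (a : A) : EReal :=
  ⨆ Ω : Finset A, ⨆ δ : Set.Ioi (0 : ℝ), localPressure π θ a (Ω : Set A) δ

end Pressure

/-! ## The crossed product by a single automorphism -/

/-- The Hilbert space `ℓ²(ℤ, H)`. -/
abbrev L2Z (H : Type v) [NormedAddCommGroup H] : Type v := lp (fun _ : ℤ => H) 2

section L2

variable {H : Type v} [NormedAddCommGroup H]

theorem memℓp_of_norm_le {ξ : L2Z H} {η : ℤ → H} {c : ℝ} (h : ∀ n, ‖η n‖ ≤ c * ‖ξ n‖) :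
    Memℓp η 2 := by
  refine memℓp_gen ?_
  have hs : Summable fun n => c ^ 2 * ‖ξ n‖ ^ 2 := by
    have := (lp.memℓp ξ).summable (by norm_num)
    simp only [ENNReal.toReal_ofNat, Real.rpow_two] at this
    exact this.mul_left _
  refine hs.of_nonneg_of_le (fun n => by positivity) (fun n => ?_)
  simp only [ENNReal.toReal_ofNat, Real.rpow_two]
  rw [← mul_pow]
  exact pow_le_pow_left₀ (norm_nonneg _) (h n) 2

theorem norm_le_of_norm_le {ξ η : L2Z H} {c : ℝ} (hc : 0 ≤ c) (h : ∀ n, ‖η n‖ ≤ c * ‖ξ n‖) :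
    ‖η‖ ≤ c * ‖ξ‖ := by
  refine lp.norm_le_of_forall_sum_le (by norm_num) (by positivity) (fun s => ?_)
  simp only [ENNReal.toReal_ofNat, Real.rpow_two]
  calc ∑ n ∈ s, ‖η n‖ ^ 2 ≤ ∑ n ∈ s, c ^ 2 * ‖ξ n‖ ^ 2 :=
        Finset.sum_le_sum fun n _ => by
          rw [← mul_pow]
          exact pow_le_pow_left₀ (norm_nonneg _) (h n) 2
    _ = c ^ 2 * ∑ n ∈ s, ‖ξ n‖ ^ 2 := by rw [Finset.mul_sum]
    _ ≤ c ^ 2 * ‖ξ‖ ^ 2 := by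
        have := lp.sum_rpow_le_norm_rpow (p := 2) (by norm_num) ξ s
        simp only [ENNReal.toReal_ofNat, Real.rpow_two] at this
        gcongr
    _ = (c * ‖ξ‖) ^ 2 := by rw [mul_pow]

theorem memℓp_shift (ξ : L2Z H) (k : ℤ) : Memℓp (fun n : ℤ => ξ (n + k)) 2 := by
  refine memℓp_gen ?_
  have := (lp.memℓp ξ).summable (by norm_num)
  exact ((Equiv.addRight k).summable_iff (f := fun n => ‖ξ n‖ ^ (2 : ℝ≥0∞).toReal)).2 this

variable [InnerProductSpace ℂ H]

/-- The shift `ξ ↦ (n ↦ ξ(n + k))` of `ℓ²(ℤ, H)`. -/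
def shift (H : Type v) [NormedAddCommGroup H] [InnerProductSpace ℂ H] (k : ℤ) :
    L2Z H →ₗ[ℂ] L2Z H where
  toFun ξ := ⟨fun n : ℤ => ξ (n + k), memℓp_shift ξ k⟩
  map_add' _ _ := rfl
  map_smul' _ _ := rfl

theorem shift_apply (k : ℤ) (ξ : L2Z H) (n : ℤ) : shift H k ξ n = ξ (n + k) := rfl

theorem norm_shift (k : ℤ) (ξ : L2Z H) : ‖shift H k ξ‖ = ‖ξ‖ := by
  rw [lp.norm_eq_tsum_rpow (by norm_num), lp.norm_eq_tsum_rpow (by norm_num)]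
  congr 1
  exact (Equiv.addRight k).tsum_eq fun n => ‖ξ n‖ ^ (2 : ℝ≥0∞).toReal

end L2

section CrossedProduct

variable {A : Type u} [CStarAlgebra A] {H : Type v} [NormedAddCommGroup H]
  [InnerProductSpace ℂ H] [CompleteSpace H]

theorem norm_rep_apply_le (π : A →⋆ₐ[ℂ] (H →L[ℂ] H)) (θ : A ≃⋆ₐ[ℂ] A) (a : A) (x : H) :
    ‖π (θ a) x‖ ≤ ‖a‖ * ‖x‖ := by
  refine (ContinuousLinearMap.le_opNorm _ _).trans ?_
  gcongr
  exact (NonUnitalStarAlgHom.norm_apply_le π _).trans (NonUnitalStarAlgHom.norm_apply_le θ a)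

/-- The operator `(π̃(a) ξ)(n) = π(θ^{-n}(a)) ξ(n)` on `ℓ²(ℤ, H)`. -/
def regularOp (π : A →⋆ₐ[ℂ] (H →L[ℂ] H)) (θ : A ≃⋆ₐ[ℂ] A) (a : A) : L2Z H →L[ℂ] L2Z H :=
  LinearMap.mkContinuous
    { toFun := fun ξ => ⟨fun n : ℤ => π ((θ ^ (-n)) a) (ξ n),
        memℓp_of_norm_le (ξ := ξ) fun n => norm_rep_apply_le π (θ ^ (-n)) a (ξ n)⟩
      map_add' := fun ξ η => by ext n; exact map_add _ _ _
      map_smul' := fun c ξ => by ext n; exact map_smul _ _ _ }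
    ‖a‖ (fun ξ => norm_le_of_norm_le (norm_nonneg a)
      fun n => norm_rep_apply_le π (θ ^ (-n)) a (ξ n))

theorem regularOp_apply (π : A →⋆ₐ[ℂ] (H →L[ℂ] H)) (θ : A ≃⋆ₐ[ℂ] A) (a : A) (ξ : L2Z H)
    (n : ℤ) : regularOp π θ a ξ n = π ((θ ^ (-n)) a) (ξ n) := rfl

/-- The representation `π̃` of `A` on `ℓ²(ℤ, H)`. -/
def regularRep (π : A →⋆ₐ[ℂ] (H →L[ℂ] H)) (θ : A ≃⋆ₐ[ℂ] A) :
    A →⋆ₐ[ℂ] (L2Z H →L[ℂ] L2Z H) where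
  toFun := regularOp π θ
  map_one' := by ext ξ n; simp [regularOp_apply]
  map_mul' a b := by ext ξ n; simp [regularOp_apply]
  map_zero' := by ext ξ n; simp [regularOp_apply]
  map_add' a b := by ext ξ n; simp [regularOp_apply]
  commutes' c := by
    ext ξ n
    simp [regularOp_apply, Algebra.algebraMap_eq_smul_one]
  map_star' a := by
    rw [ContinuousLinearMap.star_eq_adjoint, ContinuousLinearMap.eq_adjoint_iff]
    intro ξ η
    rw [lp.inner_eq_tsum, lp.inner_eq_tsum]
    refine tsum_congr fun n => ?_
    rw [regularOp_apply, regularOp_apply, map_star, map_star,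
      ContinuousLinearMap.star_eq_adjoint, ContinuousLinearMap.adjoint_inner_left]

/-- The translation `(λ ξ)(n) = ξ(n - 1)` on `ℓ²(ℤ, H)`, a unitary operator. -/
def translation (H : Type v) [NormedAddCommGroup H] [InnerProductSpace ℂ H] [CompleteSpace H] :
    unitary (L2Z H →L[ℂ] L2Z H) :=
  Unitary.linearIsometryEquiv.symm
    { toLinearEquiv := LinearEquiv.ofLinearMap (shift H (-1)) (shift H 1)
        (by ext ξ n; simp [shift_apply]) (by ext ξ n; simp [shift_apply])
      norm_map' := norm_shift (-1) }

theorem translation_apply (ξ : L2Z H) (n : ℤ) :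
    (translation H : L2Z H →L[ℂ] L2Z H) ξ n = ξ (n - 1) := rfl

/-- The crossed product `A ⋊_θ ℤ`: the C*-algebra of operators on `ℓ²(ℤ, H)` generated by
`π̃(A)` and the translation, where `π` is a faithful unital representation of `A` on `H`. -/
def crossedProduct (π : A →⋆ₐ[ℂ] (H →L[ℂ] H)) (θ : A ≃⋆ₐ[ℂ] A) :
    StarSubalgebra ℂ (L2Z H →L[ℂ] L2Z H) :=
  (StarAlgebra.adjoin ℂ (Set.range (regularRep π θ) ∪
    {(translation H : L2Z H →L[ℂ] L2Z H)})).topologicalClosure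

instance crossedProduct_isClosed (π : A →⋆ₐ[ℂ] (H →L[ℂ] H)) (θ : A ≃⋆ₐ[ℂ] A) :
    IsClosed (crossedProduct π θ : Set (L2Z H →L[ℂ] L2Z H)) :=
  StarSubalgebra.isClosed_topologicalClosure _

/-- The natural inclusion `A → A ⋊_θ ℤ`. -/
def inclusion (π : A →⋆ₐ[ℂ] (H →L[ℂ] H)) (θ : A ≃⋆ₐ[ℂ] A) :
    A →⋆ₐ[ℂ] crossedProduct π θ :=
  (regularRep π θ).codRestrict (crossedProduct π θ) fun a =>
    StarSubalgebra.le_topologicalClosure _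
      (StarAlgebra.subset_adjoin ℂ _ (Or.inl ⟨a, rfl⟩))

/-- The canonical unitary `u` of `A ⋊_θ ℤ`. -/
def canonicalUnitary (π : A →⋆ₐ[ℂ] (H →L[ℂ] H)) (θ : A ≃⋆ₐ[ℂ] A) :
    unitary (crossedProduct π θ) :=
  ⟨⟨translation H, StarSubalgebra.le_topologicalClosure _
      (StarAlgebra.subset_adjoin ℂ _ (Or.inr rfl))⟩,
    Unitary.mem_iff.2 ⟨Subtype.ext (Unitary.star_mul_self_of_mem (translation H).2),
      Subtype.ext (Unitary.mul_star_self_of_mem (translation H).2)⟩⟩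

/-- The inner automorphism `Ad u : x ↦ u x u*` of `A ⋊_θ ℤ`. -/
def adUnitary (π : A →⋆ₐ[ℂ] (H →L[ℂ] H)) (θ : A ≃⋆ₐ[ℂ] A) :
    crossedProduct π θ ≃⋆ₐ[ℂ] crossedProduct π θ :=
  Unitary.conjStarAlgAut ℂ (crossedProduct π θ) (canonicalUnitary π θ)

/-- The canonical unitary implements the automorphism: `u a u* = θ(a)`. -/
theorem adUnitary_inclusion (π : A →⋆ₐ[ℂ] (H →L[ℂ] H)) (θ : A ≃⋆ₐ[ℂ] A) (a : A) :
    adUnitary π θ (inclusion π θ a) = inclusion π θ (θ a) := by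
  have h : (translation H : L2Z H →L[ℂ] L2Z H) * regularRep π θ a
      = regularRep π θ (θ a) * (translation H : L2Z H →L[ℂ] L2Z H) := by
    ext ξ n
    change π ((θ ^ (-(n - 1))) a) (ξ (n - 1)) = π ((θ ^ (-n)) (θ a)) (ξ (n - 1))
    have : θ ^ (-(n - 1)) = θ ^ (-n) * θ := by
      rw [← zpow_add_one]; congr 1; ring
    rw [this]
    rfl
  apply Subtype.ext
  change (translation H : L2Z H →L[ℂ] L2Z H) * regularRep π θ a
    * star (translation H : L2Z H →L[ℂ] L2Z H) = regularRep π θ (θ a)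
  rw [h, mul_assoc, Unitary.mul_star_self_of_mem (translation H).2, mul_one]

end CrossedProduct

end CStarPressure

end

/-!
The equivariant inclusion of `A` into the crossed product restricts completely positive
approximations of the crossed product to approximations of `A`, once the given representation of
`A` is extended to a unital completely positive map defined on all operators; this gives `≤`.

Conversely, an element of the crossed product is compressed to the `m × m` matrix over `A` of its
entries on the summands `0, …, m - 1` of `ℓ²(ℤ, H)`, an approximation of `A` is applied entrywise,
and the resulting matrix of operators is averaged back with the powers of `u`. Without the
approximation this returns the Fejér means, which converge as `m → ∞`. On `a^{(n)}` the compression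
is diagonal with entries `θ^{-p}(a^{(n)})`, each within `2p‖a‖` of `a^{(n)}`, so the trace grows at
most by the factor `m e^{2m‖a‖}`, which does not depend on `n` and disappears after
`(1/n) log`.
-/

noncomputable section

namespace CStarPressure

universe u v w

/-! ## Completely positive maps -/

section Positivity

variable {A : Type u} {B : Type v} {N : Type w} [Fintype N]

/-- Positivity in a *-ring, expressed without reference to an order: `x` is of the form `y* y`.
It is applied to C*-algebras and to matrices over them, which carry no canonical order
instances. -/
def IsPos {R : Type*} [Mul R] [Star R] (x : R) : Prop := ∃ y : R, x = star y * y

theorem IsPos.map {R S F : Type*} [Mul R] [Star R] [Mul S] [Star S] [FunLike F R S]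
    [MulHomClass F R S] [StarHomClass F R S] (f : F) {x : R} (hx : IsPos x) : IsPos (f x) := by
  obtain ⟨y, rfl⟩ := hx
  exact ⟨f y, by rw [map_mul, map_star]⟩

theorem isPos_iff_nonneg [NonUnitalCStarAlgebra A] [PartialOrder A] [StarOrderedRing A] {x : A} :
    IsPos x ↔ 0 ≤ x :=
  CStarAlgebra.nonneg_iff_eq_star_mul_self.symm

theorem isPos_comp_iff {N' : Type*} [Fintype N'] [NonUnitalSemiring A] [StarRing A]
    (M : CStarMatrix N N (CStarMatrix N' N' A)) :
    IsPos (CStarMatrix.ofMatrix (Matrix.comp N N N' N' A M)) ↔ IsPos M := by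
  have star_mul_apply (X : CStarMatrix N N (CStarMatrix N' N' A)) (i j : N) (p q : N') :
      (star X * X) i j p q = ∑ x : N × N', star (X x.1 i x.2 p) * X x.1 j x.2 q := by
    rw [Fintype.sum_prod_type]
    exact Matrix.sum_apply p q Finset.univ fun l => star (X l i) * X l j
  constructor
  · rintro ⟨X, hX⟩
    let Y : CStarMatrix N N (CStarMatrix N' N' A) := fun i j p q => X (i, p) (j, q)
    refine ⟨Y, ?_⟩
    ext i j p q
    exact (congrFun₂ hX (i, p) (j, q)).trans (star_mul_apply Y i j p q).symm
  · rintro ⟨X, rfl⟩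
    refine ⟨fun x y => X x.1 y.1 x.2 y.2, ?_⟩
    ext x y
    exact star_mul_apply X x.1 y.1 x.2 y.2

theorem isPos_map_iff [CStarAlgebra A] [CStarAlgebra B] (f : A →⋆ₐ[ℂ] B)
    (hf : Function.Injective f) {x : A} : IsPos (f x) ↔ IsPos x := by
  let _ := CStarAlgebra.spectralOrder A
  let _ := CStarAlgebra.spectralOrder B
  have _ := CStarAlgebra.spectralOrderedRing A
  have _ := CStarAlgebra.spectralOrderedRing B
  refine ⟨fun h => isPos_iff_nonneg.2 ?_, fun h => h.map f⟩
  have hfx : 0 ≤ f x := isPos_iff_nonneg.1 h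
  have hsa : IsSelfAdjoint x := hf (by rw [map_star, hfx.isSelfAdjoint.star_eq])
  rwa [StarOrderedRing.nonneg_iff_spectrum_nonneg (R := ℝ) x hsa, ← hsa.map_spectrum_real f hf,
    ← StarOrderedRing.nonneg_iff_spectrum_nonneg (R := ℝ) (f x) hfx.isSelfAdjoint]

end Positivity

section UCP

variable {A : Type u} {B : Type v} {C : Type w} [CStarAlgebra A] [CStarAlgebra B] [CStarAlgebra C]
  {φ : A →ₗ[ℂ] B}

theorem isUCP_iff : IsUCP φ ↔ φ 1 = 1 ∧
    ∀ (k : ℕ) (M : CStarMatrix (Fin k) (Fin k) A), IsPos M → IsPos (M.map φ) := by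
  let _ := CStarAlgebra.spectralOrder A
  let _ := CStarAlgebra.spectralOrder B
  have _ := CStarAlgebra.spectralOrderedRing A
  have _ := CStarAlgebra.spectralOrderedRing B
  refine and_congr Iff.rfl ⟨?_, fun h => ?_⟩
  · rintro ⟨Φ, rfl⟩ k M hM
    exact isPos_iff_nonneg.2 (Φ.map_cstarMatrix_nonneg' k M (isPos_iff_nonneg.1 hM))
  · exact ⟨⟨φ, fun k M hM => isPos_iff_nonneg.1 (h k M (isPos_iff_nonneg.2 hM))⟩, rfl⟩

theorem IsUCP.isPos_map (hφ : IsUCP φ) {N : Type*} [Fintype N] {M : CStarMatrix N N A}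
    (hM : IsPos M) : IsPos (M.map φ) := by
  let e := Fintype.equivFin N
  have h := (isUCP_iff.1 hφ).2 _ _ (hM.map (CStarMatrix.reindexₐ ℂ A e))
  have hMφ : CStarMatrix.reindexₐ ℂ B e.symm ((CStarMatrix.reindexₐ ℂ A e M).map φ) = M.map φ := by
    ext i j
    change φ (M (e.symm (e i)) (e.symm (e j))) = φ (M i j)
    rw [e.symm_apply_apply, e.symm_apply_apply]
  exact hMφ ▸ h.map (CStarMatrix.reindexₐ ℂ B e.symm)

theorem IsUCP.comp {ψ : B →ₗ[ℂ] C} (hψ : IsUCP ψ) (hφ : IsUCP φ) : IsUCP (ψ ∘ₗ φ) :=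
  isUCP_iff.2 ⟨by rw [LinearMap.comp_apply, hφ.1, hψ.1],
    fun _ _ hM => hψ.isPos_map (hφ.isPos_map hM)⟩

theorem isUCP_starAlgHom (f : A →⋆ₐ[ℂ] B) : IsUCP (f : A →ₗ[ℂ] B) :=
  isUCP_iff.2 ⟨map_one f, fun _ _ hM => hM.map (CStarMatrix.mapₙₐ (f : A →⋆ₙₐ[ℂ] B))⟩

theorem IsUCP.map_nonneg [PartialOrder A] [StarOrderedRing A] [PartialOrder B] [StarOrderedRing B]
    (hφ : IsUCP φ) {x : A} (hx : 0 ≤ x) : 0 ≤ φ x := by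
  have h := hφ.isPos_map ((isPos_iff_nonneg.2 hx).map (CStarMatrix.toOneByOne Unit ℂ A))
  exact isPos_iff_nonneg.1 (h.map (CStarMatrix.toOneByOne Unit ℂ B).symm)

theorem IsUCP.map_star (hφ : IsUCP φ) (x : A) : φ (star x) = star (φ x) := by
  let _ := CStarAlgebra.spectralOrder A
  let _ := CStarAlgebra.spectralOrder B
  have _ := CStarAlgebra.spectralOrderedRing A
  have _ := CStarAlgebra.spectralOrderedRing B
  exact StarHomClass.map_star (PositiveLinearMap.mk₀ φ fun _ hx => hφ.map_nonneg hx) x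

theorem IsUCP.isSelfAdjoint_map (hφ : IsUCP φ) {x : A} (hx : IsSelfAdjoint x) :
    IsSelfAdjoint (φ x) := by
  rw [IsSelfAdjoint, ← hφ.map_star, hx.star_eq]

theorem IsUCP.map_algebraMap (hφ : IsUCP φ) (r : ℝ) :
    φ (algebraMap ℝ A r) = algebraMap ℝ B r := by
  rw [Algebra.algebraMap_eq_smul_one, Algebra.algebraMap_eq_smul_one, ← Complex.coe_smul,
    map_smul, hφ.1, Complex.coe_smul]

theorem IsUCP.norm_le_of_isSelfAdjoint (hφ : IsUCP φ) {x : A} (hx : IsSelfAdjoint x) :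
    ‖φ x‖ ≤ ‖x‖ := by
  let _ := CStarAlgebra.spectralOrder A
  let _ := CStarAlgebra.spectralOrder B
  have _ := CStarAlgebra.spectralOrderedRing A
  have _ := CStarAlgebra.spectralOrderedRing B
  have hφx : IsSelfAdjoint (φ x) := hφ.isSelfAdjoint_map hx
  have hle : φ x ≤ algebraMap ℝ B ‖x‖ := by
    rw [← sub_nonneg, ← hφ.map_algebraMap, ← map_sub]
    exact hφ.map_nonneg (sub_nonneg.2 hx.le_algebraMap_norm_self)
  have hge : algebraMap ℝ B (-‖x‖) ≤ φ x := by
    rw [map_neg, ← sub_nonneg, ← hφ.map_algebraMap, ← map_neg, ← map_sub]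
    exact hφ.map_nonneg (sub_nonneg.2 hx.neg_algebraMap_norm_le_self)
  rw [algebraMap_le_iff_le_spectrum (a := φ x)] at hge
  rw [le_algebraMap_iff_spectrum_le (a := φ x)] at hle
  rw [← cfc_id ℝ (φ x) hφx]
  exact norm_cfc_le (norm_nonneg x) fun t ht => abs_le.2 ⟨hge t ht, hle t ht⟩

/-- The factor `2` is not optimal, but it avoids Kadison's inequality. -/
theorem IsUCP.norm_le (hφ : IsUCP φ) (x : A) : ‖φ x‖ ≤ 2 * ‖x‖ := by
  have h : φ x = φ (realPart x : A) + Complex.I • φ (imaginaryPart x : A) := by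
    rw [← map_smul, ← map_add, realPart_add_I_smul_imaginaryPart]
  rw [h, two_mul]
  refine (norm_add_le _ _).trans (add_le_add ?_ ?_)
  · exact (hφ.norm_le_of_isSelfAdjoint (realPart x).2).trans (realPart.norm_le x)
  · rw [norm_smul, Complex.norm_I, one_mul]
    exact (hφ.norm_le_of_isSelfAdjoint (imaginaryPart x).2).trans (imaginaryPart.norm_le x)

theorem IsUCP.lipschitzWith (hφ : IsUCP φ) : LipschitzWith 2 φ := by
  simpa only [Real.toNNReal_ofNat] using AddMonoidHomClass.lipschitz_of_bound φ 2 hφ.norm_le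

end UCP

section MatrixAlgebra

variable {A : Type u} {B : Type v} [CStarAlgebra A] [CStarAlgebra B]
  {N : Type w} [Fintype N] [DecidableEq N]

/-- Matrices over a C*-algebra form a C*-algebra; Mathlib's instance asks for an order on the
entries, for which the spectral order is used. -/
instance cstarAlgebraCStarMatrix : CStarAlgebra (CStarMatrix N N A) :=
  letI := CStarAlgebra.spectralOrder A
  letI := CStarAlgebra.spectralOrderedRing A
  CStarMatrix.instCStarAlgebra

/-- Entrywise application of a *-homomorphism of C*-algebras. -/
def matMapHom (N : Type w) [Fintype N] [DecidableEq N] (f : A →⋆ₐ[ℂ] B) :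
    CStarMatrix N N A →⋆ₐ[ℂ] CStarMatrix N N B :=
  { CStarMatrix.mapₙₐ (f : A →⋆ₙₐ[ℂ] B) with
    map_one' := by ext i j; simp [CStarMatrix.one_apply, apply_ite f]
    commutes' c := by
      ext i j
      simp [CStarMatrix.algebraMap_apply, apply_ite f, AlgHomClass.commutes] }

theorem matMapHom_injective {f : A →⋆ₐ[ℂ] B} (hf : Function.Injective f) :
    Function.Injective (matMapHom N f) :=
  CStarMatrix.map_injective hf

theorem IsUCP.mapₗ {φ : A →ₗ[ℂ] B} (hφ : IsUCP φ) :
    IsUCP (CStarMatrix.mapₗ φ : CStarMatrix N N A →ₗ[ℂ] CStarMatrix N N B) := by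
  refine isUCP_iff.2 ⟨?_, fun k M hM => ?_⟩
  · ext i j
    simp [CStarMatrix.mapₗ, CStarMatrix.one_apply, apply_ite φ, hφ.1]
  · exact (isPos_comp_iff (A := B) (M.map (CStarMatrix.mapₗ φ))).1
      (hφ.isPos_map ((isPos_comp_iff (A := A) M).2 hM))

theorem IsUCP.of_starAlgHom_comp {C : Type*} [CStarAlgebra C] {f : B →⋆ₐ[ℂ] C}
    (hf : Function.Injective f) {φ : A →ₗ[ℂ] B} (h : IsUCP ((f : B →ₗ[ℂ] C) ∘ₗ φ)) : IsUCP φ := by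
  refine isUCP_iff.2 ⟨hf (by simpa using h.1), fun k M hM => ?_⟩
  exact (isPos_map_iff (matMapHom (Fin k) f) (matMapHom_injective hf)).1 (h.isPos_map hM)

end MatrixAlgebra

section Compression

open scoped ComplexOrder

variable {N : Type w} [Fintype N] {H : Type*} [NormedAddCommGroup H]
  [InnerProductSpace ℂ H] {L : Type*} [NormedAddCommGroup L] [InnerProductSpace ℂ L]

/-- The operator on the Hilbert space direct sum `Hᴺ` defined by a matrix of operators on `H`. -/
def matOp (M : CStarMatrix N N (H →L[ℂ] H)) :
    PiLp 2 (fun _ : N => H) →L[ℂ] PiLp 2 (fun _ : N => H) :=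
  ((PiLp.continuousLinearEquiv 2 ℂ (fun _ : N => H)).symm : _ →L[ℂ] _) ∘L
    ContinuousLinearMap.pi fun i => ∑ j, M i j ∘L PiLp.proj 2 (fun _ : N => H) j

theorem matOp_apply (M : CStarMatrix N N (H →L[ℂ] H)) (ξ : PiLp 2 (fun _ : N => H)) (i : N) :
    matOp M ξ i = ∑ j, M i j (ξ j) := by
  simp [matOp]

theorem inner_matOp (M : CStarMatrix N N (H →L[ℂ] H)) (ξ η : PiLp 2 (fun _ : N => H)) :
    ⟪ξ, matOp M η⟫_ℂ = ∑ i, ∑ j, ⟪ξ i, M i j (η j)⟫_ℂ := by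
  simp [PiLp.inner_apply, matOp_apply, inner_sum]

theorem matOp_injective :
    Function.Injective (matOp : CStarMatrix N N (H →L[ℂ] H) → _) := by
  classical
  intro M M' h
  ext i j ξ
  simpa [matOp_apply, Pi.single_apply, apply_ite] using
    congrArg (fun T => T (WithLp.toLp 2 (Pi.single j ξ)) i) h

variable [CompleteSpace H] [CompleteSpace L]

variable (N H) in
/-- `matOp` as a *-homomorphism: the matrix algebra over `B(H)` acts on `Hᴺ`. -/
def matOpHom [DecidableEq N] : CStarMatrix N N (H →L[ℂ] H) →⋆ₐ[ℂ]
    (PiLp 2 (fun _ : N => H) →L[ℂ] PiLp 2 (fun _ : N => H)) where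
  toFun := matOp
  map_one' := by
    ext ξ i
    rw [matOp_apply, Finset.sum_eq_single i]
    · simp
    · intro j _ hj
      simp [CStarMatrix.one_apply_ne' hj]
    · simp
  map_mul' M M' := by
    ext ξ i
    simp only [matOp_apply, CStarMatrix.mul_apply, mul_apply_eq_comp, _root_.sum_apply, map_sum]
    exact Finset.sum_comm
  map_zero' := by ext ξ i; simp [matOp_apply]
  map_add' M M' := by ext ξ i; simp [matOp_apply, Finset.sum_add_distrib]
  commutes' c := by
    ext ξ i
    rw [matOp_apply, Finset.sum_eq_single i]
    · simp [CStarMatrix.algebraMap_apply]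
    · intro j _ hj
      simp [CStarMatrix.algebraMap_apply, hj.symm]
    · simp
  map_star' M := by
    rw [ContinuousLinearMap.star_eq_adjoint, ContinuousLinearMap.eq_adjoint_iff]
    intro ξ η
    rw [← inner_conj_symm, inner_matOp, inner_matOp, map_sum]
    simp_rw [map_sum, inner_conj_symm]
    rw [Finset.sum_comm]
    refine Finset.sum_congr rfl fun i _ => Finset.sum_congr rfl fun j _ => ?_
    rw [CStarMatrix.star_apply, ContinuousLinearMap.star_eq_adjoint,
      ContinuousLinearMap.adjoint_inner_left]

theorem isPos_op_iff (T : H →L[ℂ] H) : IsPos T ↔ ∀ ξ, 0 ≤ ⟪ξ, T ξ⟫_ℂ := by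
  rw [isPos_iff_nonneg, ContinuousLinearMap.nonneg_iff_isPositive]
  refine ⟨fun h ξ => h.inner_nonneg_right ξ, fun h => ?_⟩
  refine (ContinuousLinearMap.isPositive_iff_complex T).2 fun ξ => ?_
  have hconj : ⟪T ξ, ξ⟫_ℂ = ⟪ξ, T ξ⟫_ℂ := by
    rw [← inner_conj_symm, RCLike.conj_eq_iff_im]
    exact (RCLike.nonneg_iff.1 (h ξ)).2
  rw [hconj]
  exact ⟨(RCLike.nonneg_iff_exists_ofReal.1 (h ξ)).elim fun r hr => by rw [← hr.2]; simp,
    (RCLike.nonneg_iff.1 (h ξ)).1⟩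

theorem isPos_matrix_op_iff (M : CStarMatrix N N (H →L[ℂ] H)) :
    IsPos M ↔ ∀ ξ : N → H, 0 ≤ ∑ i, ∑ j, ⟪ξ i, M i j (ξ j)⟫_ℂ := by
  classical
  rw [← isPos_map_iff (matOpHom N H) matOp_injective, isPos_op_iff]
  exact ⟨fun h ξ => (h (WithLp.toLp 2 ξ)).trans_eq (inner_matOp M _ _),
    fun h ξ => (h ξ).trans_eq (inner_matOp M ξ ξ).symm⟩

/-- The compression `T ↦ V* T V` of operators along `V`. -/
def compress (V : H →L[ℂ] L) : (L →L[ℂ] L) →ₗ[ℂ] (H →L[ℂ] H) where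
  toFun T := V.adjoint ∘L T ∘L V
  map_add' S T := by ext; simp
  map_smul' c T := by ext; simp

theorem inner_compress_apply (V : H →L[ℂ] L) (T : L →L[ℂ] L) (ξ η : H) :
    ⟪ξ, compress V T η⟫_ℂ = ⟪V ξ, T (V η)⟫_ℂ :=
  ContinuousLinearMap.adjoint_inner_right V ξ (T (V η))

theorem isUCP_compress {V : H →L[ℂ] L} (hV : V.adjoint ∘L V = 1) : IsUCP (compress V) := by
  refine isUCP_iff.2 ⟨hV, fun k M hM => (isPos_matrix_op_iff _).2 fun ξ => ?_⟩
  simp only [CStarMatrix.map_apply, inner_compress_apply]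
  exact (isPos_matrix_op_iff M).1 hM fun i => V (ξ i)

theorem isUCP_compress_comp {A : Type*} [CStarAlgebra A] {V : H →L[ℂ] L}
    (hV : V.adjoint ∘L V = 1) (τ : A →⋆ₐ[ℂ] (L →L[ℂ] L)) :
    IsUCP (compress V ∘ₗ τ.toLinearMap) :=
  (isUCP_compress hV).comp (isUCP_starAlgHom τ)

/-- The operator `ξ ↦ (Sₚ ξ)ₚ` from `H` to `Hᴺ`. -/
def columnOp (S : N → H →L[ℂ] H) : H →L[ℂ] PiLp 2 (fun _ : N => H) :=
  ((PiLp.continuousLinearEquiv 2 ℂ (fun _ : N => H)).symm : (N → H) →L[ℂ] _) ∘L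
    ContinuousLinearMap.pi S

theorem adjoint_columnOp_comp (S : N → H →L[ℂ] H) :
    (columnOp S).adjoint ∘L columnOp S = ∑ p, star (S p) * S p := by
  ext η
  refine ext_inner_left ℂ fun ξ => ?_
  simp [columnOp, inner_sum, ContinuousLinearMap.star_eq_adjoint, PiLp.inner_apply,
    ContinuousLinearMap.adjoint_inner_right]

variable [DecidableEq N]

/-- The map `[Tₚq] ↦ ∑ Sₚ* Tₚq Sq`, the compression of matrices along the column operator with
entries `Sₚ`. -/
def columnCompress (S : N → H →L[ℂ] H) : CStarMatrix N N (H →L[ℂ] H) →ₗ[ℂ] (H →L[ℂ] H) :=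
  compress (columnOp S) ∘ₗ (matOpHom N H).toLinearMap

theorem columnCompress_apply (S : N → H →L[ℂ] H) (M : CStarMatrix N N (H →L[ℂ] H)) :
    columnCompress S M = ∑ p, ∑ q, star (S p) * M p q * S q := by
  ext η
  refine ext_inner_left ℂ fun ξ => (inner_compress_apply _ _ ξ η).trans ?_
  refine (inner_matOp M _ _).trans ?_
  simp [columnOp, inner_sum, ContinuousLinearMap.star_eq_adjoint,
    ContinuousLinearMap.adjoint_inner_right]

theorem isUCP_columnCompress {S : N → H →L[ℂ] H} (hS : ∑ p, star (S p) * S p = 1) :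
    IsUCP (columnCompress S) :=
  isUCP_compress_comp ((adjoint_columnOp_comp S).trans hS) (matOpHom N H)

/-- The block `[Vₚ* T Vq]` of an operator `T` relative to a family of operators `Vₚ : H → L`. -/
def blockCompress (V : N → H →L[ℂ] L) : (L →L[ℂ] L) →ₗ[ℂ] CStarMatrix N N (H →L[ℂ] H) where
  toFun T := CStarMatrix.ofMatrix fun p q => (V p).adjoint ∘L T ∘L V q
  map_add' S T := by ext p q ξ; exact map_add (V p).adjoint (S (V q ξ)) (T (V q ξ))
  map_smul' c T := by ext p q ξ; exact map_smul (V p).adjoint c (T (V q ξ))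

theorem isUCP_blockCompress {V : N → H →L[ℂ] L}
    (hV : ∀ p q, (V p).adjoint ∘L V q = if p = q then 1 else 0) : IsUCP (blockCompress V) := by
  refine isUCP_iff.2 ⟨?_, fun k M hM => ?_⟩
  · ext1 p q
    exact (hV p q).trans CStarMatrix.one_apply.symm
  have hpos (ξ : Fin k × N → H) : 0 ≤ ∑ x : Fin k × N, ∑ y : Fin k × N,
      ⟪ξ x, (V x.2).adjoint (M x.1 y.1 (V y.2 (ξ y)))⟫_ℂ := by
    refine ((isPos_matrix_op_iff M).1 hM fun i => ∑ p, V p (ξ (i, p))).trans_eq ?_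
    simp only [Fintype.sum_prod_type, map_sum, sum_inner, inner_sum,
      ContinuousLinearMap.adjoint_inner_right]
    exact Finset.sum_congr rfl fun i _ =>
      (Finset.sum_congr rfl fun j _ => Finset.sum_comm).trans Finset.sum_comm
  exact (isPos_comp_iff (A := H →L[ℂ] H) (M.map (blockCompress V))).1
    ((isPos_matrix_op_iff _).2 hpos)

end Compression

/-! ## Traces on finite-dimensional C*-algebras -/

section SpectralProjection

theorem finite_spectrum (K : Type*) {R : Type*} [Field K] [Ring R] [Algebra K R]
    [FiniteDimensional K R] (x : R) : (spectrum K x).Finite := by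
  cases subsingleton_or_nontrivial R
  · rw [spectrum.of_subsingleton]
    exact Set.finite_empty
  refine ((minpoly K x).rootSet_finite K).subset fun r hr => ?_
  have hroot := spectrum.subset_polynomial_aeval x (minpoly K x) ⟨r, hr, rfl⟩
  rw [minpoly.aeval, spectrum.zero_eq, Set.mem_singleton_iff] at hroot
  exact Polynomial.mem_rootSet.2
    ⟨minpoly.ne_zero (Algebra.IsIntegral.isIntegral x), by simpa using hroot⟩

variable {B : Type u} [CStarAlgebra B]

/-- The spectral projection of `h` at the real number `r`. It is a junk value unless the indicator
function of `{r}` is continuous on the spectrum of `h`, as it is in finite dimension. -/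
def specProj (h : B) (r : ℝ) : B := cfc (fun t : ℝ => if t = r then 1 else 0) h

theorem exp_smul_sub_add_one_le_exp [PartialOrder B] [StarOrderedRing B] {k : B}
    (hk : IsSelfAdjoint k) (r : ℝ) :
    Real.exp r • (k - algebraMap ℝ B r + 1) ≤ NormedSpace.exp k := by
  have htangent (t : ℝ) : Real.exp r * (t - r + 1) ≤ Real.exp t := by
    calc Real.exp r * (t - r + 1) ≤ Real.exp r * Real.exp (t - r) := by
          gcongr
          exact Real.add_one_le_exp (t - r)
      _ = Real.exp t := by rw [← Real.exp_add, add_sub_cancel]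
  rw [← CFC.real_exp_eq_normedSpace_exp hk]
  refine le_of_eq_of_le ?_ (cfc_mono fun t _ => htangent t)
  rw [cfc_const_mul _ _ k, cfc_add_const _ _ k, cfc_sub _ _ k, cfc_id' ℝ k, cfc_const r k, map_one]

variable [FiniteDimensional ℂ B]

theorem finite_spectrum_real (h : B) : (spectrum ℝ h).Finite :=
  have : FiniteDimensional ℝ B := FiniteDimensional.complexToReal B
  finite_spectrum ℝ h

theorem continuousOn_spectrum_real (h : B) (f : ℝ → ℝ) : ContinuousOn f (spectrum ℝ h) :=
  (finite_spectrum_real h).continuousOn f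

theorem isStarProjection_specProj (h : B) (r : ℝ) : IsStarProjection (specProj h r) := by
  refine ⟨?_, cfc_predicate _ _⟩
  rw [IsIdempotentElem, specProj, ← cfc_mul _ _ h (continuousOn_spectrum_real h _)
    (continuousOn_spectrum_real h _)]
  congr 1
  ext t
  simp

theorem mul_specProj {h : B} (hh : IsSelfAdjoint h) (r : ℝ) :
    h * specProj h r = r • specProj h r := by
  nth_rw 1 [← cfc_id' ℝ h hh]
  rw [specProj, ← cfc_mul _ _ h (continuousOn_spectrum_real h _) (continuousOn_spectrum_real h _),
    ← cfc_smul _ _ h (continuousOn_spectrum_real h _)]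
  congr 1
  ext t
  by_cases ht : t = r <;> simp [ht]

theorem cfc_eq_sum_specProj (h : B) (f : ℝ → ℝ) :
    cfc f h = ∑ r ∈ (finite_spectrum_real h).toFinset, f r • specProj h r := by
  simp_rw [specProj, ← cfc_smul _ _ h (continuousOn_spectrum_real h _)]
  rw [← cfc_sum _ h _ fun _ _ => continuousOn_spectrum_real h _]
  refine cfc_congr fun t ht => ?_
  have ht' : t ∈ (finite_spectrum_real h).toFinset := (finite_spectrum_real h).mem_toFinset.2 ht
  simp [ht']

theorem sum_specProj {h : B} (hh : IsSelfAdjoint h) :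
    ∑ r ∈ (finite_spectrum_real h).toFinset, specProj h r = 1 := by
  simpa [cfc_const_one ℝ h hh] using (cfc_eq_sum_specProj h fun _ => 1).symm

theorem specProj_ne_zero {h : B} (hh : IsSelfAdjoint h) {r : ℝ} (hr : r ∈ spectrum ℝ h) :
    specProj h r ≠ 0 := by
  intro h0
  rw [specProj, ← cfc_zero ℝ h] at h0
  simpa using eqOn_of_cfc_eq_cfc h0 (continuousOn_spectrum_real h _)
    (continuousOn_spectrum_real h _) hh hr

end SpectralProjection

section MinimalProjection

variable {B : Type u} [CStarAlgebra B] [FiniteDimensional ℂ B]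

theorem IsMinimalProjection.exists_smul_eq {e x : B} (he : IsMinimalProjection e)
    (hx : IsSelfAdjoint x) (hex : e * x = x) : ∃ r : ℝ, x = r • e := by
  have hxe : x * e = x := by
    simpa only [star_mul, hx.star_eq, he.1.2.star_eq] using congrArg star hex
  have specProj_eq {r : ℝ} (hr : r ∈ spectrum ℝ x) (hr0 : r ≠ 0) : specProj x r = e := by
    refine (he.2.2 _ (isStarProjection_specProj x r) ?_).resolve_left (specProj_ne_zero hx hr)
    have hfactor : specProj x r = r⁻¹ • (x * specProj x r) := by
      rw [mul_specProj hx r, inv_smul_smul₀ hr0]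
    rw [hfactor, mul_smul_comm, ← mul_assoc, hex]
  by_cases h : ∃ r ∈ spectrum ℝ x, r ≠ 0
  · obtain ⟨r, hr, hr0⟩ := h
    refine ⟨r, ?_⟩
    rw [← specProj_eq hr hr0, ← mul_specProj hx, specProj_eq hr hr0, hxe]
  · push Not at h
    refine ⟨0, ?_⟩
    rw [zero_smul, ← cfc_id' ℝ x hx, cfc_congr (g := fun _ => 0) h, cfc_const_zero]

theorem finrank_range_mulLeft_lt {p g : B} (hp : IsIdempotentElem p)
    (hg : IsIdempotentElem g) (hpg : p * g = g) (hgp : g * p = g) (hne : g ≠ p) :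
    Module.finrank ℂ (LinearMap.mulLeft ℂ g).range <
      Module.finrank ℂ (LinearMap.mulLeft ℂ p).range := by
  refine Submodule.finrank_lt_finrank_of_lt (SetLike.lt_iff_le_and_exists.2 ⟨?_, p, ?_, ?_⟩)
  · rintro _ ⟨x, rfl⟩
    exact ⟨g * x, by simp [← mul_assoc, hpg]⟩
  · exact ⟨p, hp⟩
  · rintro ⟨x, rfl⟩
    refine hne (hgp.symm.trans ?_)
    rw [LinearMap.mulLeft_apply, ← mul_assoc, hg.eq]

theorem exists_multiset_isMinimalProjection {p : B} (hp : IsStarProjection p) :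
    ∃ s : Multiset B, (∀ e ∈ s, IsMinimalProjection e) ∧ s.sum = p := by
  induction hn : Module.finrank ℂ (LinearMap.mulLeft ℂ p).range using
    Nat.strong_induction_on generalizing p with | _ n ih
  subst hn
  by_cases h0 : p = 0
  · exact ⟨0, by simp, by simp [h0]⟩
  by_cases hmin : IsMinimalProjection p
  · exact ⟨{p}, by simpa, by simp⟩
  obtain ⟨f, hf, hpf, hf0, hfp⟩ : ∃ f : B, IsStarProjection f ∧ p * f = f ∧ f ≠ 0 ∧ f ≠ p := by
    simpa [IsMinimalProjection, hp, h0] using hmin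
  have hfp' : f * p = f := by
    simpa only [star_mul, hf.2.star_eq, hp.2.star_eq] using congrArg star hpf
  obtain ⟨s, hs, hsf⟩ := ih _ (finrank_range_mulLeft_lt hp.1 hf.1 hpf hfp' hfp) hf rfl
  have hsub : IsStarProjection (p - f) := hf.sub_of_mul_eq_left hp hfp'
  obtain ⟨t, ht, htf⟩ := ih _ (finrank_range_mulLeft_lt hp.1 hsub.1
    (by rw [mul_sub, hp.1.eq, hpf]) (by rw [sub_mul, hp.1.eq, hfp']) (by simpa using hf0)) hsub rfl
  refine ⟨s + t, fun e he => (Multiset.mem_add.1 he).elim (hs e) (ht e), ?_⟩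
  rw [Multiset.sum_add, hsf, htf, add_sub_cancel]

end MinimalProjection

section Trace

variable {B : Type u} [CStarAlgebra B] {τ : B →ₗ[ℂ] ℂ}

theorem re_apply_real_smul (τ : B →ₗ[ℂ] ℂ) (r : ℝ) (x : B) : (τ (r • x)).re = r * (τ x).re := by
  rw [← Complex.coe_smul, map_smul, smul_eq_mul, Complex.re_ofReal_mul]

variable [FiniteDimensional ℂ B]

theorem IsCanonicalTrace.re_projection_nonneg (hτ : IsCanonicalTrace τ) {p : B}
    (hp : IsStarProjection p) : 0 ≤ (τ p).re := by
  obtain ⟨s, hs, rfl⟩ := exists_multiset_isMinimalProjection hp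
  have htrace : τ s.sum = s.card := by
    rw [map_multiset_sum, Multiset.map_congr rfl fun e he => hτ.2 e (hs e he)]
    simp
  simp [htrace]

section Order

variable [PartialOrder B] [StarOrderedRing B]

theorem IsCanonicalTrace.re_nonneg (hτ : IsCanonicalTrace τ) {x : B} (hx : 0 ≤ x) :
    0 ≤ (τ x).re := by
  rw [← cfc_id' ℝ x hx.isSelfAdjoint, cfc_eq_sum_specProj, map_sum, Complex.re_sum]
  refine Finset.sum_nonneg fun r hr => ?_
  rw [re_apply_real_smul]
  exact mul_nonneg (spectrum_nonneg_of_nonneg hx ((finite_spectrum_real x).mem_toFinset.1 hr))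
    (hτ.re_projection_nonneg (isStarProjection_specProj x r))

theorem IsCanonicalTrace.re_projection_mul_mono (hτ : IsCanonicalTrace τ) {p x y : B}
    (hp : IsStarProjection p) (hxy : x ≤ y) : (τ (p * x)).re ≤ (τ (p * y)).re := by
  have hconj : τ (p * (y - x)) = τ (star p * (y - x) * p) := by
    rw [hτ.1 _ p, ← mul_assoc, hp.2.star_eq, hp.1.eq]
  rw [← sub_nonneg, ← Complex.sub_re, ← map_sub, ← mul_sub, hconj]
  exact hτ.re_nonneg (star_left_conjugate_nonneg (sub_nonneg.2 hxy) p)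

theorem IsCanonicalTrace.exp_mul_re_specProj_le (hτ : IsCanonicalTrace τ) {h k : B}
    (hh : IsSelfAdjoint h) (hk : IsSelfAdjoint k) (hhk : h ≤ k) (r : ℝ) :
    Real.exp r * (τ (specProj h r)).re ≤ (τ (specProj h r * NormedSpace.exp k)).re := by
  set p := specProj h r with hp_def
  have hp : IsStarProjection p := isStarProjection_specProj h r
  have hpk : r * (τ p).re ≤ (τ (p * k)).re := by
    rw [← re_apply_real_smul, hp_def, ← mul_specProj hh, hτ.1]
    exact hτ.re_projection_mul_mono hp hhk
  refine le_trans ?_ (hτ.re_projection_mul_mono hp (exp_smul_sub_add_one_le_exp hk r))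
  have hexpand : (τ (p * (k - algebraMap ℝ B r + 1))).re =
      (τ (p * k)).re - r * (τ p).re + (τ p).re := by
    rw [mul_add, mul_sub, mul_one, Algebra.algebraMap_eq_smul_one, mul_smul_comm, mul_one, map_add,
      map_sub, Complex.add_re, Complex.sub_re, re_apply_real_smul]
  rw [mul_smul_comm, re_apply_real_smul, hexpand]
  exact mul_le_mul_of_nonneg_left (by linarith) (Real.exp_nonneg r)

theorem IsCanonicalTrace.re_exp_mono (hτ : IsCanonicalTrace τ) {h k : B}
    (hh : IsSelfAdjoint h) (hk : IsSelfAdjoint k) (hhk : h ≤ k) :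
    (τ (NormedSpace.exp h)).re ≤ (τ (NormedSpace.exp k)).re := by
  rw [← CFC.real_exp_eq_normedSpace_exp hh, cfc_eq_sum_specProj h, map_sum, Complex.re_sum,
    ← one_mul (NormedSpace.exp k), ← sum_specProj hh, Finset.sum_mul, map_sum, Complex.re_sum]
  refine Finset.sum_le_sum fun r _ => ?_
  rw [re_apply_real_smul]
  exact hτ.exp_mul_re_specProj_le hh hk hhk r

end Order

theorem IsCanonicalTrace.re_exp_le_of_norm_sub_le (hτ : IsCanonicalTrace τ) {h k : B}
    (hh : IsSelfAdjoint h) (hk : IsSelfAdjoint k) {c : ℝ} (hc : ‖h - k‖ ≤ c) :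
    (τ (NormedSpace.exp h)).re ≤ Real.exp c * (τ (NormedSpace.exp k)).re := by
  let _ := CStarAlgebra.spectralOrder B
  have _ := CStarAlgebra.spectralOrderedRing B
  have hle : h ≤ k + algebraMap ℝ B c := by
    rw [← sub_le_iff_le_add']
    exact (hh.sub hk).le_algebraMap_norm_self.trans (algebraMap_mono B hc)
  have hsa : IsSelfAdjoint (algebraMap ℝ B c) := .algebraMap B (.all c)
  refine (hτ.re_exp_mono hh (hk.add hsa) hle).trans_eq ?_
  let _ : NormedAlgebra ℚ B := NormedAlgebra.restrictScalars ℚ ℝ B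
  rw [NormedSpace.exp_add_of_commute (Algebra.commutes' c k).symm, ← re_apply_real_smul,
    ← NormedSpace.algebraMap_exp_comm, ← Algebra.commutes, ← Algebra.smul_def, Real.exp_eq_exp_ℝ]

end Trace

section MurrayVonNeumann

variable {B : Type u} [CStarAlgebra B]

theorem mul_star_mul_self_of_isIdempotentElem {v : B} (h : IsIdempotentElem (star v * v)) :
    v * (star v * v) = v := by
  rw [← sub_eq_zero, ← CStarRing.star_mul_self_eq_zero_iff]
  have hexpand : star (v * (star v * v) - v) * (v * (star v * v) - v) =
      star v * v * (star v * v) * (star v * v) - star v * v * (star v * v) -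
        (star v * v * (star v * v) - star v * v) := by
    simp only [star_sub, star_mul, star_star, mul_sub, sub_mul, mul_assoc]
  rw [hexpand, h.eq, h.eq, sub_self]

theorem IsMinimalProjection.self_mul_star {v : B} (he : IsMinimalProjection (star v * v)) :
    IsMinimalProjection (v * star v) := by
  have hv : v * star v * v = v := by
    rw [mul_assoc, mul_star_mul_self_of_isIdempotentElem he.1.1]
  have hv' : star v * v * star v = star v := by
    simpa only [star_mul, star_star, mul_assoc] using congrArg star hv
  have hsa : IsSelfAdjoint (v * star v) := .mul_star_self v
  refine ⟨⟨?_, hsa⟩, fun h0 => he.2.1 ?_, fun g hg hvg => ?_⟩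
  · rw [IsIdempotentElem, ← mul_assoc, hv]
  · rw [(CStarRing.mul_star_self_eq_zero_iff v).1 h0, mul_zero]
  have hgv : g * (v * star v) = g := by
    simpa only [star_mul, star_star, hg.2.star_eq] using congrArg star hvg
  have hproj : IsStarProjection (star v * g * v) := by
    refine ⟨?_, hg.2.conjugate' v⟩
    calc star v * g * v * (star v * g * v) = star v * (g * (v * star v) * g) * v := by
          simp only [mul_assoc]
      _ = star v * g * v := by rw [hgv, hg.1.eq]
  have hback : v * (star v * g * v) * star v = g := by
    calc v * (star v * g * v) * star v = v * star v * (g * (v * star v)) := by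
          simp only [mul_assoc]
      _ = g := by rw [hgv, hvg]
  refine (he.2.2 _ hproj (by rw [← mul_assoc, ← mul_assoc, hv'])).imp (fun h => ?_) fun h => ?_
  · rw [← hback, h, mul_zero, zero_mul]
  · rw [← hback, h, ← mul_assoc, hv]

theorem IsMinimalProjection.exists_star_mul_self_eq [FiniteDimensional ℂ B] {e c : B}
    (he : IsMinimalProjection e) (hce : c * e ≠ 0) :
    ∃ y, star (c * y) * (c * y) = e := by
  let _ := CStarAlgebra.spectralOrder B
  have _ := CStarAlgebra.spectralOrderedRing B
  obtain ⟨s, hs⟩ := he.exists_smul_eq (.star_mul_self (c * e)) (by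
    rw [star_mul, he.1.2.star_eq, ← mul_assoc, ← mul_assoc e e, he.1.1.eq])
  have hs_pos : 0 < s := by
    by_contra! hs_nonpos
    have hle : star (c * e) * (c * e) ≤ 0 :=
      hs.trans_le (smul_nonpos_of_nonpos_of_nonneg hs_nonpos he.1.nonneg)
    exact hce ((CStarRing.star_mul_self_eq_zero_iff _).1 (hle.antisymm (star_mul_self_nonneg _)))
  refine ⟨(√s)⁻¹ • e, ?_⟩
  rw [mul_smul_comm, star_smul, star_trivial, smul_mul_smul_comm, hs, smul_smul, ← mul_inv,
    Real.mul_self_sqrt hs_pos.le, inv_mul_cancel₀ hs_pos.ne', one_smul]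

theorem IsMinimalProjection.of_map {C : Type v} [CStarAlgebra C] {f : B →⋆ₙₐ[ℂ] C}
    (hf : Function.Injective f) {b : B} (h : IsMinimalProjection (f b)) :
    IsMinimalProjection b := by
  refine ⟨⟨hf ?_, hf ?_⟩, fun hb => h.2.1 (by rw [hb, map_zero]), fun g hg hbg => ?_⟩
  · rw [map_mul, h.1.1.eq]
  · rw [map_star, h.1.2.star_eq]
  · refine (h.2.2 (f g) (hg.map f) (by rw [← map_mul, hbg])).imp (fun h0 => hf ?_) fun hb => hf hb
    rw [h0, map_zero]

end MurrayVonNeumann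

section MatrixTrace

variable {B : Type u} [CStarAlgebra B] {N : Type w}

instance [Finite N] [FiniteDimensional ℂ B] : FiniteDimensional ℂ (CStarMatrix N N B) :=
  inferInstanceAs (FiniteDimensional ℂ (Matrix N N B))

variable [Fintype N]

theorem exp_ofMatrix_diagonal [DecidableEq N] (d : N → B) :
    NormedSpace.exp (CStarMatrix.ofMatrix (Matrix.diagonal d)) =
      CStarMatrix.ofMatrix (Matrix.diagonal fun p => NormedSpace.exp (d p)) := by
  let _ : NormedAlgebra ℚ B := NormedAlgebra.restrictScalars ℚ ℂ B
  exact (Matrix.exp_diagonal d).trans (congrArg Matrix.diagonal (funext (Pi.coe_exp d)))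

variable (N) in
/-- The functional `Tr ⊗ τ` on matrices over `B`. -/
def matTrace (τ : B →ₗ[ℂ] ℂ) : CStarMatrix N N B →ₗ[ℂ] ℂ :=
  τ ∘ₗ Matrix.traceLinearMap N ℂ B ∘ₗ CStarMatrix.ofMatrixₗ.symm.toLinearMap

theorem matTrace_apply (τ : B →ₗ[ℂ] ℂ) (M : CStarMatrix N N B) :
    matTrace N τ M = ∑ p, τ (M p p) :=
  map_sum τ _ _

theorem matTrace_mul_comm {τ : B →ₗ[ℂ] ℂ} (hτ : ∀ x y, τ (x * y) = τ (y * x))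
    (x y : CStarMatrix N N B) : matTrace N τ (x * y) = matTrace N τ (y * x) := by
  simp only [matTrace_apply, CStarMatrix.mul_apply, map_sum]
  rw [Finset.sum_comm]
  exact Finset.sum_congr rfl fun p _ => Finset.sum_congr rfl fun q _ => hτ _ _

variable [DecidableEq N]

/-- The corner embedding `b ↦ e_{pp} ⊗ b`. -/
def matCorner (p : N) : B →⋆ₙₐ[ℂ] CStarMatrix N N B where
  toFun b := CStarMatrix.ofMatrix (Matrix.single p p b)
  map_smul' c b := (Matrix.smul_single c p p b).symm
  map_zero' := Matrix.single_zero p p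
  map_add' := Matrix.single_add p p
  map_mul' b c := (Matrix.single_mul_single_same (i := p) (j := p) (k := p) b c).symm
  map_star' b := (Matrix.conjTranspose_single p p b).symm

theorem matCorner_apply_self (p : N) (b : B) : matCorner p b p p = b :=
  Matrix.single_apply_same p p b

theorem matCorner_injective (p : N) : Function.Injective (matCorner p : B → CStarMatrix N N B) :=
  fun b c h => by rw [← matCorner_apply_self p b, h, matCorner_apply_self]

theorem matTrace_matCorner (τ : B →ₗ[ℂ] ℂ) (p : N) (b : B) :
    matTrace N τ (matCorner p b) = τ b :=
  congrArg τ (Matrix.trace_single_eq_same p b)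

theorem matCorner_one_mul_mul (p : N) (x : CStarMatrix N N B) :
    matCorner p 1 * x * matCorner p 1 = matCorner p (x p p) := by
  refine (Matrix.single_mul_mul_single p p p p (1 : B) x 1).trans ?_
  rw [one_mul, mul_one]
  rfl

theorem sum_matCorner_one : ∑ p : N, matCorner p (1 : B) = 1 :=
  Matrix.sum_single_one

-- Every minimal projection of a matrix algebra is equivalent to one inside a diagonal corner.
theorem IsCanonicalTrace.matTrace [FiniteDimensional ℂ B] {τ : B →ₗ[ℂ] ℂ}
    (hτ : IsCanonicalTrace τ) : IsCanonicalTrace (matTrace N τ) := by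
  refine ⟨matTrace_mul_comm hτ.1, fun e he => ?_⟩
  obtain ⟨p, hp⟩ : ∃ p : N, matCorner p (1 : B) * e ≠ 0 := by
    by_contra! hzero
    refine he.2.1 ?_
    rw [← one_mul e, ← sum_matCorner_one, Finset.sum_mul, Finset.sum_eq_zero fun p _ => hzero p]
  obtain ⟨y, rfl⟩ := he.exists_star_mul_self_eq hp
  set c : CStarMatrix N N B := matCorner p 1 with hc
  have hsc : star c = c := by rw [hc, ← map_star, star_one]
  have hcorner : c * y * star (c * y) = matCorner p ((y * star y) p p) := by
    rw [← matCorner_one_mul_mul, ← hc, star_mul, hsc]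
    simp only [mul_assoc]
  have hmin := he.self_mul_star
  rw [hcorner] at hmin
  rw [matTrace_mul_comm hτ.1, hcorner, matTrace_matCorner]
  exact hτ.2 _ (.of_map (matCorner_injective p) hmin)

end MatrixTrace

/-! ## Extension of representations to completely positive maps -/

section PositiveFunctional

open scoped ComplexOrder ComplexStarModule

variable {A : Type u} {D : Type v} [CStarAlgebra A] [PartialOrder A] [StarOrderedRing A]
  [CStarAlgebra D] [PartialOrder D] [StarOrderedRing D]

variable (D) in
/-- The cone of elements with nonnegative real part. Positivity on this cone makes the
complexification of a real functional positive. -/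
def nonnegRealPart : PointedCone ℝ D :=
  (PointedCone.positive ℝ D).comap ((selfAdjoint.submodule ℝ D).subtype ∘ₗ realPart)

theorem mem_nonnegRealPart {x : D} : x ∈ nonnegRealPart D ↔ 0 ≤ (ℜ x : D) := Iff.rfl

theorem extendRCLike_nonneg {g : Module.Dual ℝ D} (hg : ∀ x ∈ nonnegRealPart D, 0 ≤ g x) {x : D}
    (hx : 0 ≤ x) : 0 ≤ (g.extendRCLike x : ℂ) := by
  have re_I_smul : (ℜ (Complex.I • x) : D) = 0 := by
    rw [realPart_I_smul, hx.isSelfAdjoint.imaginaryPart, neg_zero, ZeroMemClass.coe_zero]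
  have hI : 0 ≤ g (Complex.I • x) := hg _ (mem_nonnegRealPart.2 re_I_smul.ge)
  have hnegI : 0 ≤ -g (Complex.I • x) := by
    rw [← map_neg]
    refine hg _ (mem_nonnegRealPart.2 ?_)
    rw [map_neg, NegMemClass.coe_neg, re_I_smul, neg_zero]
  refine RCLike.nonneg_iff.2 ⟨?_, ?_⟩
  · rw [Module.Dual.re_extendRCLike_apply]
    exact hg x (mem_nonnegRealPart.2 (hx.isSelfAdjoint.coe_realPart.symm ▸ hx))
  · rw [Module.Dual.im_extendRCLike_apply]
    exact le_antisymm (neg_nonpos.2 hI) hnegI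

theorem re_map_realPart (φ : A →ₚ[ℂ] ℂ) (a : A) : (φ (ℜ a : A)).re = (φ a).re := by
  conv_rhs => rw [← realPart_add_I_smul_imaginaryPart a, map_add, map_smul]
  have him : (φ (ℑ a : A)).im = 0 :=
    Complex.conj_eq_iff_im.1 (by rw [← Complex.star_def, ← map_star, (ℑ a).2.star_eq])
  simp [him]

theorem map_realPart (π : A →⋆ₐ[ℂ] D) (a : A) : (ℜ (π a) : D) = π (ℜ a : A) := by
  rw [realPart_apply_coe, realPart_apply_coe, ← map_star, ← map_add]
  exact ((π : A →ₗ[ℂ] D).map_smul_of_tower (2⁻¹ : ℝ) (a + star a)).symm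

theorem exists_positive_extension (π : A →⋆ₐ[ℂ] D) (hπ : Function.Injective π) (φ : A →ₚ[ℂ] ℂ) :
    ∃ g : D →ₚ[ℂ] ℂ, ∀ a, g (π a) = φ a := by
  let e := LinearEquiv.ofInjective ((π : A →ₗ[ℂ] D).restrictScalars ℝ) hπ
  let f : D →ₗ.[ℝ] ℝ := ⟨_, Complex.reLm ∘ₗ φ.toLinearMap.restrictScalars ℝ ∘ₗ e.symm.toLinearMap⟩
  have f_apply (a : A) : f (e a) = (φ a).re :=
    congrArg (fun b => (φ b).re) (e.symm_apply_apply a)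
  have f_nonneg (y : f.domain) (hy : (y : D) ∈ nonnegRealPart D) : 0 ≤ f y := by
    obtain ⟨a, rfl⟩ := e.surjective y
    have ha : 0 ≤ (ℜ a : A) := isPos_iff_nonneg.1 <| (isPos_map_iff π hπ).1 <|
      isPos_iff_nonneg.2 ((mem_nonnegRealPart.1 hy).trans_eq (map_realPart π a))
    rw [f_apply, ← re_map_realPart]
    exact (Complex.nonneg_iff.1 (map_nonneg φ ha)).1
  have domain_cofinal (y : D) : ∃ x : f.domain, (x : D) + y ∈ nonnegRealPart D := by
    refine ⟨e (algebraMap ℝ A ‖(ℜ y : D)‖), mem_nonnegRealPart.2 ?_⟩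
    have he : (e (algebraMap ℝ A ‖(ℜ y : D)‖) : D) = algebraMap ℝ D ‖(ℜ y : D)‖ :=
      (isUCP_starAlgHom π).map_algebraMap _
    rw [he, map_add, AddMemClass.coe_add, IsSelfAdjoint.coe_realPart (.algebraMap D (.all _)),
      ← neg_le_iff_add_nonneg']
    exact IsSelfAdjoint.neg_algebraMap_norm_le_self (ℜ y).2
  obtain ⟨g : Module.Dual ℝ D, hgf, hg⟩ := riesz_extension _ f f_nonneg domain_cofinal
  have hgπ (a : A) : g (π a) = (φ a).re := (hgf (e a)).trans (f_apply a)
  refine ⟨PositiveLinearMap.mk₀ (g.extendRCLike : D →ₗ[ℂ] ℂ) fun x => extendRCLike_nonneg hg,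
    fun a => Complex.ext ?_ ?_⟩
  · exact (Module.Dual.re_extendRCLike_apply (𝕜 := ℂ) g (π a)).trans (hgπ a)
  · refine (Module.Dual.im_extendRCLike_apply (𝕜 := ℂ) g (π a)).trans ?_
    change -g (Complex.I • π a) = _
    rw [← map_smul, hgπ, map_smul, smul_eq_mul, Complex.I_mul_re, neg_neg]

end PositiveFunctional

section DirectSum

variable {D : Type u} [CStarAlgebra D] {ι : Type v} {L : ι → Type w}
  [∀ i, NormedAddCommGroup (L i)]

theorem lp_two_summable_sq (ξ : lp L 2) : Summable fun i => ‖ξ i‖ ^ 2 := by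
  simpa only [ENNReal.toReal_ofNat, Real.rpow_two] using (lp.memℓp ξ).summable (by norm_num)

theorem lp_two_norm_sq (ξ : lp L 2) : ‖ξ‖ ^ 2 = ∑' i, ‖ξ i‖ ^ 2 := by
  simpa only [ENNReal.toReal_ofNat, Real.rpow_two] using
    lp.norm_rpow_eq_tsum (p := 2) (by norm_num) ξ

variable [∀ i, InnerProductSpace ℂ (L i)] [∀ i, CompleteSpace (L i)]
  (σ : ∀ i, D →⋆ₐ[ℂ] (L i →L[ℂ] L i))

theorem norm_sq_starAlgHom_apply_le (x : D) (i : ι) (η : L i) :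
    ‖σ i x η‖ ^ 2 ≤ ‖x‖ ^ 2 * ‖η‖ ^ 2 := by
  rw [← mul_pow]
  gcongr
  exact (σ i x).le_of_opNorm_le (NonUnitalStarAlgHom.norm_apply_le (σ i) x) η

theorem summable_sq_starAlgHom_apply (x : D) (ξ : lp L 2) :
    Summable fun i => ‖σ i x (ξ i)‖ ^ 2 :=
  ((lp_two_summable_sq ξ).mul_left (‖x‖ ^ 2)).of_nonneg_of_le (fun _ => sq_nonneg _)
    fun i => norm_sq_starAlgHom_apply_le σ x i (ξ i)

/-- The operator `(ξᵢ)ᵢ ↦ (σᵢ(x) ξᵢ)ᵢ` on the Hilbert space direct sum. -/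
def directSumOp (x : D) : lp L 2 →L[ℂ] lp L 2 :=
  LinearMap.mkContinuous
    { toFun := fun ξ => ⟨fun i => σ i x (ξ i), memℓp_gen <| by
        simpa only [ENNReal.toReal_ofNat, Real.rpow_two] using
          summable_sq_starAlgHom_apply σ x ξ⟩
      map_add' := fun ξ η => by ext i; exact map_add _ _ _
      map_smul' := fun c ξ => by ext i; exact map_smul _ _ _ }
    ‖x‖ fun ξ => by
      rw [← sq_le_sq₀ (norm_nonneg _) (by positivity), mul_pow, lp_two_norm_sq, lp_two_norm_sq,
        ← tsum_mul_left]
      exact (summable_sq_starAlgHom_apply σ x ξ).tsum_le_tsum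
        (fun i => norm_sq_starAlgHom_apply_le σ x i (ξ i)) ((lp_two_summable_sq ξ).mul_left _)

theorem directSumOp_apply (x : D) (ξ : lp L 2) (i : ι) : directSumOp σ x ξ i = σ i x (ξ i) := rfl

/-- The Hilbert space direct sum of a family of representations. -/
def directSumRep : D →⋆ₐ[ℂ] (lp L 2 →L[ℂ] lp L 2) where
  toFun := directSumOp σ
  map_one' := by ext; simp [directSumOp_apply]
  map_mul' _ _ := by ext; simp [directSumOp_apply]
  map_zero' := by ext; simp [directSumOp_apply]
  map_add' _ _ := by ext; simp [directSumOp_apply]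
  commutes' _ := by ext; simp [directSumOp_apply, Algebra.algebraMap_eq_smul_one]
  map_star' x := by
    rw [ContinuousLinearMap.star_eq_adjoint, ContinuousLinearMap.eq_adjoint_iff]
    intro ξ η
    rw [lp.inner_eq_tsum, lp.inner_eq_tsum]
    refine tsum_congr fun i => ?_
    rw [directSumOp_apply, directSumOp_apply, map_star,
      ContinuousLinearMap.star_eq_adjoint, ContinuousLinearMap.adjoint_inner_left]

theorem directSumRep_single [DecidableEq ι] (x : D) (i : ι) (η : L i) :
    directSumRep σ x (lp.single 2 i η) = lp.single 2 i (σ i x η) := by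
  ext j
  change σ j x (lp.single 2 i η j) = _
  by_cases h : j = i
  · subst h; simp
  · simp [lp.single_apply, h]

end DirectSum

section RepresentationExtension

open scoped ComplexOrder

variable {A : Type u} [CStarAlgebra A] {K : Type v} [NormedAddCommGroup K] [InnerProductSpace ℂ K]

theorem exists_isometry_of_inner_eq {L : Type*} [NormedAddCommGroup L] [InnerProductSpace ℂ L]
    [CompleteSpace L] {ι : Type*} {x : ι → K} {y : ι → L}
    (hxy : ∀ i j, ⟪x i, x j⟫_ℂ = ⟪y i, y j⟫_ℂ)
    (hx : Dense (Submodule.span ℂ (Set.range x) : Set K)) :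
    ∃ V : K →L[ℂ] L, (∀ i, V (x i) = y i) ∧ ∀ ξ, ‖V ξ‖ = ‖ξ‖ := by
  have norm_eq (s : ι →₀ ℂ) :
      ‖Finsupp.linearCombination ℂ y s‖ = ‖Finsupp.linearCombination ℂ x s‖ := by
    rw [← sq_eq_sq₀ (norm_nonneg _) (norm_nonneg _), ← inner_self_eq_norm_sq (𝕜 := ℂ),
      ← inner_self_eq_norm_sq (𝕜 := ℂ)]
    simp only [Finsupp.linearCombination_apply, Finsupp.sum, sum_inner, inner_sum, inner_smul_left,
      inner_smul_right, hxy]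
  have hd : DenseRange (Finsupp.linearCombination ℂ x) := by
    rwa [DenseRange, ← LinearMap.coe_range, Finsupp.range_linearCombination]
  let V := (Finsupp.linearCombination ℂ y).extendOfNorm (Finsupp.linearCombination ℂ x)
  have hV (s : ι →₀ ℂ) :
      V (Finsupp.linearCombination ℂ x s) = Finsupp.linearCombination ℂ y s :=
    LinearMap.extendOfNorm_eq hd ⟨1, fun s => by rw [one_mul, norm_eq]⟩ s
  refine ⟨V, fun i => by simpa using hV (Finsupp.single i 1), fun ξ => ?_⟩
  refine hd.induction_on (p := fun ξ => ‖V ξ‖ = ‖ξ‖) ξ ?_ fun s => by rw [hV, norm_eq]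
  exact isClosed_eq (by fun_prop) (by fun_prop)

variable [CompleteSpace K] (σ : A →⋆ₐ[ℂ] (K →L[ℂ] K))

theorem inner_map_apply (a b : A) (ξ η : K) : ⟪σ a ξ, σ b η⟫_ℂ = ⟪ξ, σ (star a * b) η⟫_ℂ := by
  rw [map_mul, map_star, ContinuousLinearMap.star_eq_adjoint, mul_apply_eq_comp,
    ContinuousLinearMap.adjoint_inner_right]

/-- A set of vectors generating mutually orthogonal cyclic subspaces. -/
def IsCyclicallyOrthogonal (S : Set K) : Prop :=
  S.Pairwise fun ξ η => ∀ a, ⟪ξ, σ a η⟫_ℂ = 0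

variable {σ} in
theorem IsCyclicallyOrthogonal.dense_of_maximal {S : Set K}
    (hS : Maximal (IsCyclicallyOrthogonal σ) S) :
    Dense (Submodule.span ℂ (Set.range fun p : S × A => σ p.2 (p.1 : K)) : Set K) := by
  rw [Submodule.dense_iff_topologicalClosure_eq_top, Submodule.topologicalClosure_eq_top_iff,
    Submodule.eq_bot_iff]
  intro ζ hζ
  rw [Submodule.mem_orthogonal] at hζ
  have hSζ (ξ : K) (hξ : ξ ∈ S) (a : A) : ⟪σ a ξ, ζ⟫_ℂ = 0 :=
    hζ _ (Submodule.subset_span ⟨(⟨ξ, hξ⟩, a), rfl⟩)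
  have hmem : ζ ∈ S := by
    refine hS.le_of_ge (y := insert ζ S) ?_ (Set.subset_insert _ _) (Set.mem_insert _ _)
    refine hS.prop.insert fun ξ hξ _ => ⟨fun a => inner_eq_zero_symm.1 (hSζ ξ hξ a), fun a => ?_⟩
    rw [← hSζ ξ hξ (star a), map_star, ContinuousLinearMap.star_eq_adjoint,
      ContinuousLinearMap.adjoint_inner_left]
  have := hSζ ζ hmem 1
  rwa [map_one, one_apply_eq_self, inner_self_eq_zero] at this

theorem exists_cyclic_decomposition : ∃ S : Set K, IsCyclicallyOrthogonal σ S ∧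
    Dense (Submodule.span ℂ (Set.range fun p : S × A => σ p.2 (p.1 : K)) : Set K) := by
  obtain ⟨S, hS⟩ := zorn_subset {S | IsCyclicallyOrthogonal σ S} fun c hc hchain =>
    ⟨⋃₀ c, (Set.pairwise_sUnion hchain.directedOn).2 hc, fun _ => Set.subset_sUnion_of_mem⟩
  exact ⟨S, hS.prop, IsCyclicallyOrthogonal.dense_of_maximal hS⟩

/-- The functional `a ↦ ⟪ξ, σ(a) ξ⟫`. -/
def vectorFunctional [PartialOrder A] [StarOrderedRing A] (ξ : K) : A →ₚ[ℂ] ℂ :=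
  PositiveLinearMap.mk₀
    ((innerSL ℂ ξ).toLinearMap ∘ₗ (ContinuousLinearMap.apply ℂ K ξ).toLinearMap ∘ₗ σ.toLinearMap)
    fun x hx => (isPos_op_iff (σ x)).1 ((isPos_iff_nonneg.2 hx).map σ) ξ

theorem inner_toPreGNS {D : Type*} [CStarAlgebra D] [PartialOrder D] [StarOrderedRing D]
    (g : D →ₚ[ℂ] ℂ) (a b : D) :
    ⟪((g.toPreGNS a : g.PreGNS) : g.GNS), ((g.toPreGNS b : g.PreGNS) : g.GNS)⟫_ℂ =
      g (star a * b) := by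
  rw [UniformSpace.Completion.inner_coe, PositiveLinearMap.preGNS_inner_def,
    PositiveLinearMap.ofPreGNS_toPreGNS, PositiveLinearMap.ofPreGNS_toPreGNS]

theorem exists_ucp_extension {H : Type*} [NormedAddCommGroup H] [InnerProductSpace ℂ H]
    [CompleteSpace H] (π : A →⋆ₐ[ℂ] (H →L[ℂ] H)) (hπ : Function.Injective π) :
    ∃ Φ : (H →L[ℂ] H) →ₗ[ℂ] (K →L[ℂ] K), IsUCP Φ ∧ ∀ a, Φ (π a) = σ a := by
  classical
  let _ := CStarAlgebra.spectralOrder A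
  have _ := CStarAlgebra.spectralOrderedRing A
  obtain ⟨S, hS, hdense⟩ := exists_cyclic_decomposition σ
  choose g hg using fun ξ : S => exists_positive_extension π hπ (vectorFunctional σ (ξ : K))
  let τ := directSumRep fun ξ : S => (g ξ).gnsStarAlgHom
  let y (p : S × A) : lp (fun ξ : S => (g ξ).GNS) 2 :=
    lp.single 2 p.1 (((g p.1).toPreGNS (π p.2) : (g p.1).PreGNS) : (g p.1).GNS)
  have τ_y (x : A) (p : S × A) : τ (π x) (y p) = y (p.1, x * p.2) := by
    refine (directSumRep_single _ _ _ _).trans (congrArg _ ?_)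
    refine (PositiveLinearMap.gnsNonUnitalStarAlgHom_apply_coe _).trans ?_
    rw [map_mul]
    rfl
  have inner_y (p q : S × A) : ⟪σ p.2 p.1, σ q.2 q.1⟫_ℂ = ⟪y p, y q⟫_ℂ := by
    obtain ⟨⟨ξ, a⟩, ⟨η, b⟩⟩ := p, q
    rw [inner_map_apply, lp.inner_single_left]
    by_cases h : ξ = η
    · subst h
      rw [lp.single_apply_self, inner_toPreGNS, ← map_star, ← map_mul, hg]
      rfl
    · rw [show y (η, b) ξ = 0 by simp [y, lp.single_apply, h], inner_zero_right]
      exact hS ξ.2 η.2 (Subtype.coe_ne_coe.2 h) _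
  obtain ⟨V, hV, V_norm⟩ := exists_isometry_of_inner_eq inner_y hdense
  have hVV : V.adjoint ∘L V = 1 := V.norm_map_iff_adjoint_comp_self.1 V_norm
  refine ⟨compress V ∘ₗ τ.toLinearMap, isUCP_compress_comp hVV τ, fun a => ?_⟩
  have intertwine : τ (π a) ∘L V = V ∘L σ a := by
    refine ContinuousLinearMap.ext_on hdense ?_
    rintro _ ⟨p, rfl⟩
    simp only [ContinuousLinearMap.comp_apply]
    rw [hV, τ_y, ← hV, map_mul]
    rfl
  change V.adjoint ∘L τ (π a) ∘L V = σ a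
  rw [intertwine, ← ContinuousLinearMap.comp_assoc, hVV]
  rfl

end RepresentationExtension

/-! ## Coefficients in the crossed product -/

section Monomials

variable {A : Type u} [CStarAlgebra A] {H : Type v} [NormedAddCommGroup H]
  [InnerProductSpace ℂ H] [CompleteSpace H] (π : A →⋆ₐ[ℂ] (H →L[ℂ] H)) (θ : A ≃⋆ₐ[ℂ] A)

theorem translation_inv_apply (ξ : L2Z H) (n : ℤ) :
    ((translation H)⁻¹ : unitary (L2Z H →L[ℂ] L2Z H)).1 ξ n = ξ (n + 1) := by
  have h : (translation H).1 ((translation H)⁻¹.1 ξ) = ξ := by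
    rw [← mul_apply_eq_comp, ← Submonoid.coe_mul, mul_inv_cancel]
    rfl
  conv_rhs => rw [← h, translation_apply, add_sub_cancel_right]

theorem translation_zpow_apply (k : ℤ) (ξ : L2Z H) (n : ℤ) :
    (translation H ^ k : unitary (L2Z H →L[ℂ] L2Z H)).1 ξ n = ξ (n - k) := by
  induction k using Int.induction_on generalizing n ξ with
  | zero => simp
  | succ i ih =>
    rw [zpow_add_one, Submonoid.coe_mul, mul_apply_eq_comp, ih, translation_apply]
    exact congrArg (fun t => ξ t) (by ring)
  | pred i ih =>
    rw [zpow_sub_one, Submonoid.coe_mul, mul_apply_eq_comp, ih, translation_inv_apply]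
    exact congrArg (fun t => ξ t) (by ring)

theorem map_unitary_zpow {C D : Type*} [CStarAlgebra C] [CStarAlgebra D] (f : C →⋆ₐ[ℂ] D)
    (v : unitary C) (k : ℤ) :
    f (v ^ k : unitary C) = (Unitary.map ⟨(f : C →* D), map_star f⟩ v ^ k : unitary D) := by
  rw [← map_zpow]
  rfl

/-- The element `x uᵏ` of the crossed product. -/
def monomial (x : A) (k : ℤ) : crossedProduct π θ :=
  inclusion π θ x * (canonicalUnitary π θ ^ k : unitary (crossedProduct π θ))

theorem monomial_zero (x : A) : monomial π θ x 0 = inclusion π θ x := by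
  rw [monomial, zpow_zero, Submonoid.coe_one, mul_one]

theorem monomial_one_left (k : ℤ) :
    monomial π θ 1 k = (canonicalUnitary π θ ^ k : unitary (crossedProduct π θ)) := by
  rw [monomial, map_one, one_mul]

theorem coe_monomial_apply (x : A) (k : ℤ) (ξ : L2Z H) (n : ℤ) :
    (monomial π θ x k : L2Z H →L[ℂ] L2Z H) ξ n = π ((θ ^ (-n)) x) (ξ (n - k)) := by
  have coe_zpow : ((canonicalUnitary π θ ^ k : unitary (crossedProduct π θ)) :
      crossedProduct π θ).1 = (translation H ^ k : unitary (L2Z H →L[ℂ] L2Z H)) :=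
    map_unitary_zpow (crossedProduct π θ).subtype (canonicalUnitary π θ) k
  rw [← translation_zpow_apply k ξ n, ← coe_zpow]
  rfl

theorem monomial_mul_monomial (x y : A) (k l : ℤ) :
    monomial π θ x k * monomial π θ y l = monomial π θ (x * (θ ^ k) y) (k + l) := by
  ext ξ n
  change (monomial π θ x k : L2Z H →L[ℂ] L2Z H) ((monomial π θ y l : L2Z H →L[ℂ] L2Z H) ξ) n = _
  rw [coe_monomial_apply, coe_monomial_apply, coe_monomial_apply, map_mul, map_mul,
    mul_apply_eq_comp, ← StarAlgEquiv.mul_apply, ← zpow_add, sub_sub, neg_sub, sub_eq_neg_add]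

theorem adUnitary_monomial (x : A) (k : ℤ) :
    adUnitary π θ (monomial π θ x k) = monomial π θ (θ x) k := by
  have hu : adUnitary π θ (canonicalUnitary π θ ^ k : unitary (crossedProduct π θ)) =
      (canonicalUnitary π θ ^ k : unitary (crossedProduct π θ)) := by
    rw [adUnitary, Unitary.conjStarAlgAut_apply]
    exact congrArg Subtype.val (Commute.self_zpow (canonicalUnitary π θ) k).mul_inv_cancel
  rw [monomial, map_mul, adUnitary_inclusion, hu, monomial]

/-- The submonoid of all monomials; it contains the generators of the crossed product and their
adjoints. -/
def monomialSubmonoid : Submonoid (crossedProduct π θ) where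
  carrier := Set.range fun p : A × ℤ => monomial π θ p.1 p.2
  one_mem' := ⟨(1, 0), (monomial_zero π θ 1).trans (map_one (inclusion π θ))⟩
  mul_mem' := by
    rintro _ _ ⟨p, rfl⟩ ⟨q, rfl⟩
    exact ⟨(p.1 * (θ ^ p.2) q.1, p.2 + q.2), (monomial_mul_monomial π θ p.1 q.1 p.2 q.2).symm⟩

theorem generators_subset_monomialSubmonoid :
    (Set.range (regularRep π θ) ∪ {(translation H).1}) ∪
      star (Set.range (regularRep π θ) ∪ {(translation H).1}) ⊆
        ((monomialSubmonoid π θ).map (crossedProduct π θ).subtype : Set (L2Z H →L[ℂ] L2Z H)) := by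
  have regularRep_mem (x : A) :
      regularRep π θ x ∈ (monomialSubmonoid π θ).map (crossedProduct π θ).subtype :=
    ⟨inclusion π θ x, ⟨(x, 0), monomial_zero π θ x⟩, rfl⟩
  have unitary_mem (v : unitary (crossedProduct π θ)) (k : ℤ) (hv : v = canonicalUnitary π θ ^ k) :
      (v : crossedProduct π θ).1 ∈ (monomialSubmonoid π θ).map (crossedProduct π θ).subtype :=
    ⟨v, ⟨(1, k), hv ▸ monomial_one_left π θ k⟩, rfl⟩
  rintro T ((⟨x, rfl⟩ | rfl) | (⟨x, hx⟩ | hT))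
  · exact regularRep_mem x
  · exact unitary_mem (canonicalUnitary π θ) 1 (zpow_one _).symm
  · rw [← star_star T, ← hx, ← map_star]
    exact regularRep_mem _
  · rw [← star_star T, Set.mem_singleton_iff.1 hT]
    exact unitary_mem (canonicalUnitary π θ)⁻¹ (-1) (zpow_neg_one _).symm

variable {π θ} in
theorem crossedProduct_induction {P : crossedProduct π θ → Prop} (closed : IsClosed {z | P z})
    (zero : P 0) (add : ∀ y z, P y → P z → P (y + z)) (smul : ∀ (c : ℂ) z, P z → P (c • z))
    (monomial : ∀ x k, P (monomial π θ x k)) (z : crossedProduct π θ) : P z := by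
  have adjoin_induction (T : L2Z H →L[ℂ] L2Z H) (hT : T ∈ StarAlgebra.adjoin ℂ
      (Set.range (regularRep π θ) ∪ {(translation H).1})) : ∃ h, P ⟨T, h⟩ := by
    rw [← StarSubalgebra.mem_toSubalgebra, ← Subalgebra.mem_toSubmodule,
      StarAlgebra.adjoin_eq_span] at hT
    replace hT := Submodule.span_mono
      (Submonoid.closure_le.2 (generators_subset_monomialSubmonoid π θ)) hT
    induction hT using Submodule.span_induction with
    | mem _ h =>
      obtain ⟨_, ⟨p, rfl⟩, rfl⟩ := h
      exact ⟨_, monomial p.1 p.2⟩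
    | zero => exact ⟨_, zero⟩
    | add _ _ _ _ hx hy => exact ⟨_, add _ _ hx.choose_spec hy.choose_spec⟩
    | smul c _ _ hx => exact ⟨_, smul c _ hx.choose_spec⟩
  refine closed.closure_subset_iff.2 subset_rfl ?_
  rw [closure_subtype]
  refine closure_mono ?_ z.2
  intro T hT
  obtain ⟨h, hP⟩ := adjoin_induction T hT
  exact ⟨⟨T, h⟩, hP, rfl⟩

end Monomials

section Coefficients

variable {A : Type u} [CStarAlgebra A] {H : Type v} [NormedAddCommGroup H]
  [InnerProductSpace ℂ H]

/-- The inclusion of the `p`-th summand `H` of `ℓ²(ℤ, H)`. -/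
def summandIncl (H : Type v) [NormedAddCommGroup H] [InnerProductSpace ℂ H] (p : ℤ) :
    H →L[ℂ] L2Z H :=
  lp.singleContinuousLinearMap ℂ (fun _ : ℤ => H) 2 p

theorem summandIncl_apply (p q : ℤ) (ξ : H) :
    summandIncl H p ξ q = if q = p then ξ else 0 :=
  (lp.single_apply (E := fun _ : ℤ => H) 2 p ξ q).trans (Pi.single_apply p ξ q)

variable [CompleteSpace H]

theorem adjoint_summandIncl_apply (p : ℤ) (ξ : L2Z H) :
    (summandIncl H p).adjoint ξ = ξ p := by
  refine ext_inner_left ℂ fun η => ?_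
  rw [ContinuousLinearMap.adjoint_inner_right]
  exact lp.inner_single_left (G := fun _ : ℤ => H) p η ξ

theorem adjoint_summandIncl_comp (p q : ℤ) :
    (summandIncl H p).adjoint ∘L summandIncl H q = if p = q then 1 else 0 := by
  ext ξ
  rw [ContinuousLinearMap.comp_apply, adjoint_summandIncl_apply, summandIncl_apply]
  split_ifs <;> rfl

/-- The matrix coefficient at `(p, q)` of an operator on `ℓ²(ℤ, H)`, an operator on `H`. -/
def coeffOp (p q : ℤ) : (L2Z H →L[ℂ] L2Z H) →ₗ[ℂ] (H →L[ℂ] H) where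
  toFun T := (summandIncl H p).adjoint ∘L T ∘L summandIncl H q
  map_add' S T := by ext ξ; exact map_add (summandIncl H p).adjoint _ _
  map_smul' c T := by ext ξ; exact map_smul (summandIncl H p).adjoint _ _

theorem coeffOp_apply (p q : ℤ) (T : L2Z H →L[ℂ] L2Z H) (ξ : H) :
    coeffOp p q T ξ = T (summandIncl H q ξ) p :=
  adjoint_summandIncl_apply p _

theorem continuous_coeffOp (p q : ℤ) :
    Continuous (coeffOp p q : (L2Z H →L[ℂ] L2Z H) → (H →L[ℂ] H)) := by
  change Continuous fun T => (summandIncl H p).adjoint ∘L T ∘L summandIncl H q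
  fun_prop

variable {π : A →⋆ₐ[ℂ] (H →L[ℂ] H)} (θ : A ≃⋆ₐ[ℂ] A)

theorem coeffOp_monomial (x : A) (k p q : ℤ) :
    coeffOp p q (monomial π θ x k).1 = π (if p - k = q then (θ ^ (-p)) x else 0) := by
  ext ξ
  rw [coeffOp_apply, coe_monomial_apply, summandIncl_apply]
  split_ifs
  · rfl
  · rw [map_zero, map_zero, zero_apply]

variable (hπ : Function.Injective π)
include hπ

theorem coeffOp_mem_range (p q : ℤ) (z : crossedProduct π θ) :
    coeffOp p q z.1 ∈ LinearMap.range (π : A →ₗ[ℂ] (H →L[ℂ] H)) := by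
  induction z using crossedProduct_induction with
  | closed =>
    exact (NonUnitalStarAlgHom.isometry π hπ).isClosedEmbedding.isClosed_range.preimage
      ((continuous_coeffOp p q).comp continuous_subtype_val)
  | zero => exact (map_zero (coeffOp (H := H) p q)).symm ▸ zero_mem _
  | add y z hy hz => exact (map_add (coeffOp (H := H) p q) y.1 z.1).symm ▸ add_mem hy hz
  | smul c z hz => exact (map_smul (coeffOp (H := H) p q) c z.1).symm ▸ Submodule.smul_mem _ c hz
  | monomial x k => exact ⟨_, (coeffOp_monomial θ x k p q).symm⟩

/-- The matrix coefficient at `(p, q)` of an element of the crossed product, pulled back to `A`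
along the faithful representation `π`. -/
def coeff (p q : ℤ) : crossedProduct π θ →ₗ[ℂ] A :=
  (LinearEquiv.ofInjective (π : A →ₗ[ℂ] (H →L[ℂ] H)) hπ).symm.toLinearMap ∘ₗ
    (coeffOp p q ∘ₗ (crossedProduct π θ).subtype.toLinearMap).codRestrict _
      (coeffOp_mem_range θ hπ p q)

theorem map_coeff (p q : ℤ) (z : crossedProduct π θ) :
    π (coeff θ hπ p q z) = coeffOp p q z.1 :=
  congrArg Subtype.val <| (LinearEquiv.ofInjective (π : A →ₗ[ℂ] (H →L[ℂ] H)) hπ).apply_symm_apply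
    ⟨coeffOp p q z.1, coeffOp_mem_range θ hπ p q z⟩

theorem coeff_monomial (p q k : ℤ) (x : A) :
    coeff θ hπ p q (monomial π θ x k) = if p - k = q then (θ ^ (-p)) x else 0 :=
  hπ ((map_coeff θ hπ p q _).trans (coeffOp_monomial θ x k p q))

theorem coeff_inclusion (p q : ℤ) (x : A) :
    coeff θ hπ p q (inclusion π θ x) = if p = q then (θ ^ (-p)) x else 0 := by
  rw [← monomial_zero, coeff_monomial, sub_zero]

theorem inclusion_injective : Function.Injective (inclusion π θ) := by
  have leftInverse (x : A) : coeff θ hπ 0 0 (inclusion π θ x) = x := by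
    rw [coeff_inclusion, if_pos rfl, neg_zero, zpow_zero, StarAlgEquiv.one_apply]
  exact Function.LeftInverse.injective leftInverse

theorem continuous_coeff (p q : ℤ) : Continuous (coeff θ hπ p q) := by
  rw [(NonUnitalStarAlgHom.isometry π hπ).isEmbedding.continuous_iff]
  exact ((continuous_coeffOp p q).comp continuous_subtype_val).congr
    fun z => (map_coeff θ hπ p q z).symm

theorem semiconj_coeff (p q : ℤ) :
    Function.Semiconj (coeff θ hπ p q) (adUnitary π θ) θ := by
  intro z
  induction z using crossedProduct_induction with
  | closed =>
    exact isClosed_eq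
      ((continuous_coeff θ hπ p q).comp (StarAlgEquiv.isometry (adUnitary π θ)).continuous)
      ((StarAlgEquiv.isometry θ).continuous.comp (continuous_coeff θ hπ p q))
  | zero => simp only [map_zero]
  | add y z hy hz => simp only [map_add, hy, hz]
  | smul c z hz => simp only [map_smul, hz]
  | monomial x k =>
    rw [adUnitary_monomial, coeff_monomial, coeff_monomial, apply_ite θ, map_zero,
      ← StarAlgEquiv.mul_apply, ← StarAlgEquiv.mul_apply, ← zpow_add_one, ← zpow_one_add, add_comm]

/-- The compression of the crossed product to the summands `0, …, m - 1` of `ℓ²(ℤ, H)`. -/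
def coeffMatrix (m : ℕ) : crossedProduct π θ →ₗ[ℂ] CStarMatrix (Fin m) (Fin m) A where
  toFun z := CStarMatrix.ofMatrix fun p q => coeff θ hπ p q z
  map_add' y z := by ext p q; exact map_add (coeff θ hπ p q) y z
  map_smul' c z := by ext p q; exact map_smul (coeff θ hπ p q) c z

theorem isUCP_coeffMatrix (m : ℕ) : IsUCP (coeffMatrix θ hπ m) := by
  refine IsUCP.of_starAlgHom_comp (f := matMapHom (Fin m) π) (matMapHom_injective hπ) ?_
  have factor : (matMapHom (Fin m) π : _ →ₗ[ℂ] _) ∘ₗ coeffMatrix θ hπ m =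
      blockCompress (fun p : Fin m => summandIncl H p) ∘ₗ
        ((crossedProduct π θ).subtype : _ →ₗ[ℂ] _) := by
    refine LinearMap.ext fun z => CStarMatrix.ext fun p q => ?_
    exact map_coeff θ hπ p q z
  rw [factor]
  refine IsUCP.comp (isUCP_blockCompress fun p q => ?_) (isUCP_starAlgHom _)
  simpa only [Nat.cast_inj, Fin.val_inj] using adjoint_summandIncl_comp (H := H) p q

theorem coeffMatrix_inclusion (m : ℕ) (x : A) : coeffMatrix θ hπ m (inclusion π θ x) =
    CStarMatrix.ofMatrix (Matrix.diagonal fun p : Fin m => (θ ^ (-(p : ℤ))) x) := by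
  ext p q
  refine (coeff_inclusion θ hπ p q x).trans ?_
  simp only [Nat.cast_inj, Fin.val_inj, CStarMatrix.ofMatrix_apply, Matrix.diagonal_apply]

end Coefficients

/-! ## Fejér means -/

section FejerMeans

theorem inv_sqrt_mul_inv_sqrt (m : ℕ) : ((√m)⁻¹ : ℂ) * ((√m)⁻¹ : ℂ) = (m : ℂ)⁻¹ := by
  rw [← mul_inv, ← Complex.ofReal_mul, Real.mul_self_sqrt (Nat.cast_nonneg m),
    Complex.ofReal_natCast]

theorem card_filter_sub_eq (m : ℕ) (k : ℤ) :
    (Finset.univ.filter fun p : Fin m × Fin m => (p.1 : ℤ) - k = p.2).card = m - k.natAbs := by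
  rw [← Finset.card_range (m - k.natAbs)]
  refine Finset.card_bij (fun p _ => min p.1.val p.2.val) ?_ ?_ ?_
  · rintro ⟨p, q⟩ h
    simp only [Finset.mem_filter, Finset.mem_univ, true_and, Finset.mem_range] at h ⊢
    omega
  · rintro ⟨p, q⟩ h ⟨p', q'⟩ h' hmin
    simp only [Finset.mem_filter, Finset.mem_univ, true_and, Prod.mk.injEq, Fin.ext_iff]
      at h h' hmin ⊢
    omega
  · intro n hn
    rw [Finset.mem_range] at hn
    refine ⟨(⟨n + k.toNat, by omega⟩, ⟨n + (-k).toNat, by omega⟩), ?_, ?_⟩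
    · simp only [Finset.mem_filter, Finset.mem_univ, true_and]
      omega
    · simp only
      omega

theorem tendsto_natCast_sub_div_natCast (k : ℕ) :
    Filter.Tendsto (fun m : ℕ => ((m - k : ℕ) : ℂ) / m) Filter.atTop (nhds 1) := by
  have sub_div : Filter.Tendsto (fun m : ℕ => 1 - (k : ℂ) / m) Filter.atTop (nhds (1 - 0)) :=
    tendsto_const_nhds.sub (tendsto_const_div_atTop_nhds_zero_nat (k : ℂ))
  rw [sub_zero] at sub_div
  refine sub_div.congr' ?_
  filter_upwards [Filter.eventually_gt_atTop k] with m hm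
  have hm₀ : (m : ℂ) ≠ 0 := Nat.cast_ne_zero.2 (Nat.zero_lt_of_lt hm).ne'
  rw [Nat.cast_sub hm.le, _root_.sub_div, div_self hm₀]

variable {K : Type*} [NormedAddCommGroup K] [InnerProductSpace ℂ K] [CompleteSpace K]

/-- The average `m⁻¹ ∑ Wᵖ M_{pq} W⁻ᑫ` of the entries of an `m × m` matrix of operators. -/
def average (W : unitary (K →L[ℂ] K)) (m : ℕ) :
    CStarMatrix (Fin m) (Fin m) (K →L[ℂ] K) →ₗ[ℂ] (K →L[ℂ] K) :=
  columnCompress fun p => ((√m)⁻¹ : ℂ) • (W ^ (-(p : ℤ)) : unitary (K →L[ℂ] K)).1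

theorem average_apply (W : unitary (K →L[ℂ] K)) (m : ℕ)
    (M : CStarMatrix (Fin m) (Fin m) (K →L[ℂ] K)) : average W m M =
      (m : ℂ)⁻¹ • ∑ p : Fin m, ∑ q : Fin m,
        (W ^ (p : ℤ) : unitary (K →L[ℂ] K)).1 * M p q *
          (W ^ (-(q : ℤ)) : unitary (K →L[ℂ] K)).1 := by
  have star_zpow (p : ℤ) : star (W ^ (-p) : unitary (K →L[ℂ] K)).1 =
      (W ^ p : unitary (K →L[ℂ] K)).1 := by
    rw [← Unitary.coe_star, Unitary.star_eq_inv, zpow_neg, inv_inv]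
  simp only [average, columnCompress_apply, Finset.smul_sum, star_smul, star_zpow, smul_mul_assoc,
    mul_smul_comm, smul_smul, star_inv₀, Complex.star_def, Complex.conj_ofReal,
    inv_sqrt_mul_inv_sqrt]

theorem isUCP_average (W : unitary (K →L[ℂ] K)) (m : ℕ) [NeZero m] : IsUCP (average W m) := by
  refine isUCP_columnCompress ?_
  have term (p : Fin m) : star (((√m)⁻¹ : ℂ) • (W ^ (-(p : ℤ)) : unitary (K →L[ℂ] K)).1) *
      (((√m)⁻¹ : ℂ) • (W ^ (-(p : ℤ)) : unitary (K →L[ℂ] K)).1) = (m : ℂ)⁻¹ • 1 := by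
    rw [star_smul, smul_mul_smul_comm, Unitary.star_mul_self_of_mem (W ^ (-(p : ℤ))).2, star_inv₀,
      Complex.star_def, Complex.conj_ofReal, inv_sqrt_mul_inv_sqrt]
  simp_rw [term]
  rw [Finset.sum_const, Finset.card_univ, Fintype.card_fin, ← Nat.cast_smul_eq_nsmul ℂ, smul_smul,
    mul_inv_cancel₀ (NeZero.ne (m : ℂ)), one_smul]

theorem norm_average_le (W : unitary (K →L[ℂ] K)) {m : ℕ} [NeZero m]
    {M : CStarMatrix (Fin m) (Fin m) (K →L[ℂ] K)} {c : ℝ} (hM : ∀ p q, ‖M p q‖ ≤ c) :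
    ‖average W m M‖ ≤ m * c := by
  have sum_le : ‖∑ p : Fin m, ∑ q : Fin m, (W ^ (p : ℤ) : unitary (K →L[ℂ] K)).1 * M p q *
      (W ^ (-(q : ℤ)) : unitary (K →L[ℂ] K)).1‖ ≤ m * (m * c) := by
    have entry_le (p q : Fin m) : ‖(W ^ (p : ℤ) : unitary (K →L[ℂ] K)).1 * M p q *
        (W ^ (-(q : ℤ)) : unitary (K →L[ℂ] K)).1‖ ≤ c := by
      rw [CStarRing.norm_mul_coe_unitary, CStarRing.norm_coe_unitary_mul]
      exact hM p q
    refine (norm_sum_le_of_le _ fun p _ => norm_sum_le_of_le _ fun q _ => entry_le p q).trans_eq ?_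
    simp
  rw [average_apply, norm_smul, norm_inv, Complex.norm_natCast]
  calc (m : ℝ)⁻¹ * _ ≤ (m : ℝ)⁻¹ * (m * (m * c)) := by gcongr
    _ = m * c := inv_mul_cancel_left₀ (NeZero.ne (m : ℝ)) _

variable {A : Type u} [CStarAlgebra A] {H : Type v} [NormedAddCommGroup H]
  [InnerProductSpace ℂ H] [CompleteSpace H] {π : A →⋆ₐ[ℂ] (H →L[ℂ] H)} {θ : A ≃⋆ₐ[ℂ] A}
  (ρ : crossedProduct π θ →⋆ₐ[ℂ] (K →L[ℂ] K))

/-- The image of the canonical unitary under a representation `ρ` of the crossed product; it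
implements `Ad u` in `ρ`. -/
def implementingUnitary : unitary (K →L[ℂ] K) :=
  Unitary.map ⟨(ρ : crossedProduct π θ →* (K →L[ℂ] K)), map_star ρ⟩ (canonicalUnitary π θ)

theorem map_monomial (x : A) (k : ℤ) : ρ (monomial π θ x k) =
    ρ (inclusion π θ x) * (implementingUnitary ρ ^ k : unitary (K →L[ℂ] K)).1 :=
  (map_mul ρ _ _).trans (congrArg _ (map_unitary_zpow ρ (canonicalUnitary π θ) k))

theorem zpow_mul_map_inclusion_mul_zpow (x : A) (k l : ℤ) :
    (implementingUnitary ρ ^ k : unitary (K →L[ℂ] K)).1 * ρ (inclusion π θ x) *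
      (implementingUnitary ρ ^ l : unitary (K →L[ℂ] K)).1 =
        ρ (monomial π θ ((θ ^ k) x) (k + l)) := by
  rw [mul_assoc, ← map_monomial, ← one_mul ((θ ^ k) x), ← monomial_mul_monomial, map_mul,
    map_monomial ρ 1 k, map_one, map_one, one_mul]

variable (hπ : Function.Injective π)

/-- The Fejér mean of `z` in the representation `ρ`: the coefficient of `uᵏ` is multiplied by
`1 - |k| / m` if `|k| ≤ m`, and by `0` otherwise. -/
def fejerMean (m : ℕ) : crossedProduct π θ →ₗ[ℂ] (K →L[ℂ] K) :=
  average (implementingUnitary ρ) m ∘ₗ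
    CStarMatrix.mapₗ (ρ.toLinearMap ∘ₗ (inclusion π θ).toLinearMap) ∘ₗ coeffMatrix θ hπ m

theorem isUCP_fejerMean (m : ℕ) [NeZero m] : IsUCP (fejerMean ρ hπ m) :=
  (isUCP_average _ m).comp
    (((isUCP_starAlgHom ρ).comp (isUCP_starAlgHom (inclusion π θ))).mapₗ.comp
      (isUCP_coeffMatrix θ hπ m))

theorem fejerMean_monomial (m : ℕ) (x : A) (k : ℤ) : fejerMean ρ hπ m (monomial π θ x k) =
    (((m - k.natAbs : ℕ) : ℂ) / m) • ρ (monomial π θ x k) := by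
  have term (p q : Fin m) : (implementingUnitary ρ ^ (p : ℤ) : unitary (K →L[ℂ] K)).1 *
      ρ (inclusion π θ (coeff θ hπ p q (monomial π θ x k))) *
        (implementingUnitary ρ ^ (-(q : ℤ)) : unitary (K →L[ℂ] K)).1 =
      if (p : ℤ) - k = q then ρ (monomial π θ x k) else 0 := by
    rw [zpow_mul_map_inclusion_mul_zpow, coeff_monomial]
    split_ifs with h
    · rw [← StarAlgEquiv.mul_apply, ← zpow_add, add_neg_cancel, zpow_zero, StarAlgEquiv.one_apply,
        ← h, neg_sub, add_sub_cancel]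
    · rw [map_zero, map_monomial, map_zero, map_zero, zero_mul]
  refine (average_apply _ m _).trans ?_
  rw [div_eq_inv_mul, mul_smul, ← card_filter_sub_eq, Nat.cast_smul_eq_nsmul, ← Finset.sum_const,
    Finset.sum_filter, Fintype.sum_prod_type]
  exact congrArg _ (Finset.sum_congr rfl fun p _ => Finset.sum_congr rfl fun q _ => term p q)

theorem tendsto_fejerMean (z : crossedProduct π θ) :
    Filter.Tendsto (fun m : ℕ => fejerMean ρ hπ (m + 1) z) Filter.atTop (nhds (ρ z)) := by
  induction z using crossedProduct_induction with
  | closed =>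
    have equicontinuous : Equicontinuous fun m : ℕ => ⇑(fejerMean ρ hπ (m + 1)) :=
      (LipschitzWith.uniformEquicontinuous _ 2
        fun m => (isUCP_fejerMean ρ hπ (m + 1)).lipschitzWith).equicontinuous
    exact equicontinuous.isClosed_setOfPred_tendsto (isUCP_starAlgHom ρ).lipschitzWith.continuous
  | zero => simp only [map_zero, tendsto_const_nhds]
  | add y z hy hz => simpa only [map_add] using hy.add hz
  | smul c z hz => simpa only [map_smul] using hz.const_smul c
  | monomial x k =>
    have weight := (tendsto_natCast_sub_div_natCast k.natAbs).comp (Filter.tendsto_add_atTop_nat 1)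
    simpa only [fejerMean_monomial, one_smul, Function.comp_def] using
      weight.smul_const (ρ (monomial π θ x k))

theorem map_adUnitary (z : crossedProduct π θ) : ρ (adUnitary π θ z) =
    (implementingUnitary ρ).1 * ρ z * star (implementingUnitary ρ).1 := by
  change ρ ((canonicalUnitary π θ).1 * z * star (canonicalUnitary π θ).1) = _
  rw [map_mul, map_mul, map_star]
  rfl

theorem fejerMean_adUnitary (m : ℕ) [NeZero m] (z : crossedProduct π θ) :
    fejerMean ρ hπ m (adUnitary π θ z) =
      (implementingUnitary ρ).1 * fejerMean ρ hπ m z * star (implementingUnitary ρ).1 := by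
  induction z using crossedProduct_induction with
  | closed =>
    have continuous_fejerMean : Continuous (fejerMean ρ hπ m) :=
      (isUCP_fejerMean ρ hπ m).lipschitzWith.continuous
    exact isClosed_eq
      (continuous_fejerMean.comp (StarAlgEquiv.isometry (adUnitary π θ)).continuous)
      ((continuous_const.mul continuous_fejerMean).mul continuous_const)
  | zero => simp only [map_zero, mul_zero, zero_mul]
  | add y z hy hz => simp only [map_add, hy, hz, mul_add, add_mul]
  | smul c z hz => simp only [map_smul, hz, mul_smul_comm, smul_mul_assoc]
  | monomial x k =>
    rw [fejerMean_monomial, mul_smul_comm, smul_mul_assoc, ← map_adUnitary, adUnitary_monomial,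
      fejerMean_monomial]

theorem norm_fejerMean_iterate_sub (m : ℕ) [NeZero m] (z : crossedProduct π θ) (j : ℕ) :
    ‖fejerMean ρ hπ m ((adUnitary π θ)^[j] z) - ρ ((adUnitary π θ)^[j] z)‖ =
      ‖fejerMean ρ hπ m z - ρ z‖ := by
  induction j with
  | zero => rfl
  | succ j ih =>
    rw [Function.iterate_succ_apply', fejerMean_adUnitary, map_adUnitary, ← sub_mul, ← mul_sub,
      ← Unitary.coe_star, CStarRing.norm_mul_coe_unitary, CStarRing.norm_coe_unitary_mul, ih]

end FejerMeans

/-! ## Comparison of pressures -/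

section Orbits

variable {X Y : Type*} {f : X → X} {g : Y → Y} {s : X → Y}

theorem forall_mem_orbitSet {Ω : Set X} {n : ℕ} {P : X → Prop} :
    (∀ x ∈ orbitSet f Ω n, P x) ↔ ∀ j < n, ∀ w ∈ Ω, P (f^[j] w) := by
  simp only [orbitSet, Set.mem_iUnion₂, Finset.mem_range, Set.mem_image]
  exact ⟨fun h j hj w hw => h _ ⟨j, hj, w, hw, rfl⟩, fun h _ ⟨j, hj, w, hw, hx⟩ => hx ▸ h j hj w hw⟩

theorem mapsTo_orbitSet (h : Function.Semiconj s f g) {Ω : Set X} {Λ : Set Y}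
    (hΩ : Set.MapsTo s Ω Λ) (n : ℕ) : Set.MapsTo s (orbitSet f Ω n) (orbitSet g Λ n) := by
  refine forall_mem_orbitSet.2 fun j hj w hw => ?_
  rw [(h.iterate_right j).eq]
  exact Set.mem_biUnion (Finset.mem_range.2 hj) ⟨s w, hΩ hw, rfl⟩

variable {A : Type*} [CStarAlgebra A]

theorem map_orbitSum {B F : Type*} [CStarAlgebra B] [FunLike F A B] [AddMonoidHomClass F A B]
    {ι : F} {α : A → A} {β : B → B} (h : Function.Semiconj ι α β) (a : A) (n : ℕ) :
    ι (orbitSum α a n) = orbitSum β (ι a) n :=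
  (map_sum ι _ _).trans (Finset.sum_congr rfl fun j _ => (h.iterate_right j).eq a)

variable (θ : A ≃⋆ₐ[ℂ] A)

theorem isSelfAdjoint_orbitSum {a : A} (ha : IsSelfAdjoint a) (n : ℕ) :
    IsSelfAdjoint (orbitSum θ a n) :=
  isSelfAdjoint_sum _ fun j _ =>
    Function.Iterate.rec IsSelfAdjoint ha (fun _ hx => hx.map θ) j

theorem norm_map_orbitSum_sub_le (a : A) (n : ℕ) :
    ‖θ (orbitSum θ a n) - orbitSum θ a n‖ ≤ 2 * ‖a‖ := by
  have norm_iterate : ‖θ^[n] a‖ = ‖a‖ := by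
    induction n with
    | zero => rfl
    | succ n ih => rw [Function.iterate_succ_apply', StarAlgEquiv.norm_map, ih]
  have telescope : θ (orbitSum θ a n) - orbitSum θ a n = θ^[n] a - a := by
    rw [orbitSum, map_sum, ← Finset.sum_sub_distrib]
    simp only [← Function.iterate_succ_apply']
    exact Finset.sum_range_sub (fun j => θ^[j] a) n
  rw [telescope, two_mul]
  exact (norm_sub_le _ _).trans_eq (by rw [norm_iterate])

theorem norm_zpow_neg_sub_le (x : A) (k : ℕ) :
    ‖(θ ^ (-(k : ℤ))) x - x‖ ≤ k * ‖θ x - x‖ := by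
  have step (j : ℕ) : dist ((θ ^ (-(j : ℤ))) x) ((θ ^ (-((j + 1 : ℕ) : ℤ))) x) ≤ ‖θ x - x‖ := by
    have shift : (θ ^ (-(j : ℤ))) x = (θ ^ (-((j + 1 : ℕ) : ℤ))) (θ x) := by
      rw [← StarAlgEquiv.mul_apply, ← zpow_add_one, Nat.cast_succ, neg_add, neg_add_cancel_right]
    rw [shift, dist_eq_norm, ← map_sub, StarAlgEquiv.norm_map]
  have chain := dist_le_range_sum_of_dist_le (f := fun j : ℕ => (θ ^ (-(j : ℤ))) x) k
    fun {j} _ => step j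
  simpa [dist_eq_norm', norm_sub_rev] using chain

end Orbits

section TraceEstimate

variable {A : Type*} [CStarAlgebra A] {H : Type*} [NormedAddCommGroup H]
  [InnerProductSpace ℂ H] [CompleteSpace H] {π : A →⋆ₐ[ℂ] (H →L[ℂ] H)} (θ : A ≃⋆ₐ[ℂ] A)

theorem re_matTrace_exp_le {B : Type*} [CStarAlgebra B] [FiniteDimensional ℂ B]
    {τ : B →ₗ[ℂ] ℂ} (hτ : IsCanonicalTrace τ) {φ : A →ₗ[ℂ] B} (hφ : IsUCP φ)
    (hπ : Function.Injective π) {x : A} (hx : IsSelfAdjoint x) {m : ℕ} {c : ℝ}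
    (hc : ∀ p : Fin m, ‖(θ ^ (-(p : ℤ))) x - x‖ ≤ c) :
    (matTrace (Fin m) τ (NormedSpace.exp
      (CStarMatrix.mapₗ φ (coeffMatrix θ hπ m (inclusion π θ x))))).re ≤
        m * Real.exp c * (τ (NormedSpace.exp (φ x))).re := by
  have diagonal : CStarMatrix.mapₗ φ (coeffMatrix θ hπ m (inclusion π θ x)) =
      CStarMatrix.ofMatrix (Matrix.diagonal fun p : Fin m => φ ((θ ^ (-(p : ℤ))) x)) := by
    rw [coeffMatrix_inclusion]
    exact Matrix.diagonal_map (map_zero φ)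
  have term_le (p : Fin m) : (τ (NormedSpace.exp (φ ((θ ^ (-(p : ℤ))) x)))).re ≤
      Real.exp c * (τ (NormedSpace.exp (φ x))).re := by
    have hpx : IsSelfAdjoint ((θ ^ (-(p : ℤ))) x) := hx.map _
    refine hτ.re_exp_le_of_norm_sub_le (hφ.isSelfAdjoint_map hpx) (hφ.isSelfAdjoint_map hx) ?_
    rw [← map_sub]
    exact (hφ.norm_le_of_isSelfAdjoint (hpx.sub hx)).trans (hc p)
  rw [diagonal, exp_ofMatrix_diagonal, matTrace_apply, Complex.re_sum, mul_assoc]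
  simp only [CStarMatrix.ofMatrix_apply, Matrix.diagonal_apply_eq]
  calc ∑ p : Fin m, (τ (NormedSpace.exp (φ ((θ ^ (-(p : ℤ))) x)))).re
      ≤ ∑ _p : Fin m, Real.exp c * (τ (NormedSpace.exp (φ x))).re :=
        Finset.sum_le_sum fun p _ => term_le p
    _ = m * (Real.exp c * (τ (NormedSpace.exp (φ x))).re) := by
        rw [Finset.sum_const, Finset.card_univ, Fintype.card_fin, nsmul_eq_mul]

end TraceEstimate

section Pressure

theorem limsup_log_div_le {u v : ℕ → ℝ≥0∞} {c : ℝ} (hc : 0 < c)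
    (huv : ∀ n, u n ≤ ENNReal.ofReal c * v n) :
    Filter.limsup (fun n : ℕ => ENNReal.log (u n) / (n : EReal)) Filter.atTop ≤
      Filter.limsup (fun n : ℕ => ENNReal.log (v n) / (n : EReal)) Filter.atTop := by
  have log_div : Filter.Tendsto (fun n : ℕ => ((Real.log c : ℝ) : EReal) / (n : EReal))
      Filter.atTop (nhds 0) :=
    (continuous_coe_real_ereal.tendsto 0).comp (tendsto_const_div_atTop_nhds_zero_nat (Real.log c))
  have term_le (n : ℕ) : ENNReal.log (u n) / (n : EReal) ≤
      ((Real.log c : ℝ) : EReal) / (n : EReal) + ENNReal.log (v n) / (n : EReal) := by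
    have hn : (0 : EReal) ≤ n := by exact_mod_cast n.zero_le
    rw [← EReal.add_div_of_nonneg_right hn, ← ENNReal.log_ofReal_of_pos hc, ← ENNReal.log_mul_add]
    exact EReal.div_le_div_right_of_nonneg hn (ENNReal.log_monotone (huv n))
  refine (Filter.limsup_le_limsup (Filter.Eventually.of_forall term_le)).trans ?_
  refine (EReal.limsup_add_le ?_ ?_).trans_eq ?_
  · exact Or.inl (log_div.limsup_eq ▸ EReal.zero_ne_bot)
  · exact Or.inl (log_div.limsup_eq ▸ EReal.zero_ne_top)
  · rw [log_div.limsup_eq, zero_add]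

variable {A : Type*} [CStarAlgebra A] {C : Type*} [CStarAlgebra C]
  {H : Type*} [NormedAddCommGroup H] [InnerProductSpace ℂ H] [CompleteSpace H]
  {K : Type*} [NormedAddCommGroup K] [InnerProductSpace ℂ K] [CompleteSpace K]
  {π : A →⋆ₐ[ℂ] (H →L[ℂ] H)} {ρ : C →⋆ₐ[ℂ] (K →L[ℂ] K)}

/-- The quantity `Tr e^{φ(x)}` minimised in the partition function. -/
def CPA.traceExp {S : Set A} {δ : ℝ} (f : CPA π S δ) (x : A) : ℝ :=
  (f.Tr (NormedSpace.exp (f.φ x))).re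

theorem pressure_le_of_forall_exists_CPA {α : A → A} {β : C → C} {a : A} {b : C}
    (h : ∀ (Ω : Finset A), ∀ ε > 0, ∃ (Λ : Finset C), ∃ δ > 0, ∃ c > 0,
      ∀ (n : ℕ) (f : CPA ρ (orbitSet β Λ n) δ), ∃ g : CPA π (orbitSet α Ω n) ε,
        g.traceExp (orbitSum α a n) ≤ c * f.traceExp (orbitSum β b n)) :
    pressure π α a ≤ pressure ρ β b := by
  refine iSup₂_le fun Ω ε => ?_
  obtain ⟨Λ, δ, hδ, c, hc, transfer⟩ := h Ω ε ε.2
  refine le_iSup₂_of_le Λ ⟨δ, hδ⟩ (limsup_log_div_le hc fun n => ?_)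
  rw [partitionFunction, partitionFunction,
    ENNReal.mul_iInf_of_ne (ENNReal.ofReal_pos.2 hc).ne' ENNReal.ofReal_ne_top]
  refine le_iInf fun f => ?_
  obtain ⟨g, hg⟩ := transfer n f
  rw [← ENNReal.ofReal_mul hc.le]
  exact iInf_le_of_le g (ENNReal.ofReal_le_ofReal hg)

/-- The approximation of `A` obtained from one of `C` by restricting along `ι : A → C` and
composing with a ucp map extending `ρ(ι(x)) ↦ π(x)`. -/
def CPA.restrict {ι : A →⋆ₐ[ℂ] C} {T : Set C} {δ : ℝ} (f : CPA ρ T (δ / 2))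
    {Φ : (K →L[ℂ] K) →ₗ[ℂ] (H →L[ℂ] H)} (hΦ : IsUCP Φ) (hΦπ : ∀ x, Φ (ρ (ι x)) = π x)
    {S : Set A} (hST : Set.MapsTo ι S T) : CPA π S δ where
  B := f.B
  φ := f.φ ∘ₗ ι.toLinearMap
  ψ := Φ ∘ₗ f.ψ
  Tr := f.Tr
  isUCP_φ := f.isUCP_φ.comp (isUCP_starAlgHom ι)
  isUCP_ψ := hΦ.comp f.isUCP_ψ
  isCanonicalTrace := f.isCanonicalTrace
  approx x hx := calc
    ‖Φ (f.ψ (f.φ (ι x))) - π x‖ = ‖Φ (f.ψ (f.φ (ι x)) - ρ (ι x))‖ := by rw [map_sub, hΦπ]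
    _ ≤ 2 * ‖f.ψ (f.φ (ι x)) - ρ (ι x)‖ := hΦ.norm_le _
    _ < 2 * (δ / 2) := by gcongr; exact f.approx _ (hST hx)
    _ = δ := mul_div_cancel₀ δ two_ne_zero

theorem pressure_le_pressure_map {ι : A →⋆ₐ[ℂ] C} (hι : Function.Injective ι) {α : A → A}
    {β : C → C} (h : Function.Semiconj ι α β) (hρ : Function.Injective ρ) (a : A) :
    pressure π α a ≤ pressure ρ β (ι a) := by
  classical
  obtain ⟨Φ, hΦ, hΦπ⟩ := exists_ucp_extension π (ρ.comp ι) (hρ.comp hι)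
  refine pressure_le_of_forall_exists_CPA fun Ω ε hε =>
    ⟨Ω.image ι, ε / 2, half_pos hε, 1, one_pos, fun n f => ?_⟩
  have mapsTo : Set.MapsTo ι Ω (Ω.image ι) := fun x hx => Finset.mem_image_of_mem ι hx
  refine ⟨f.restrict hΦ hΦπ (mapsTo_orbitSet h mapsTo n), ?_⟩
  rw [one_mul, ← map_orbitSum h]
  exact le_rfl

end Pressure

section CrossedProduct

variable {A : Type*} [CStarAlgebra A] {θ : A ≃⋆ₐ[ℂ] A}
  {H₀ : Type*} [NormedAddCommGroup H₀] [InnerProductSpace ℂ H₀] [CompleteSpace H₀]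
  {π₀ : A →⋆ₐ[ℂ] (H₀ →L[ℂ] H₀)}
  {H : Type*} [NormedAddCommGroup H] [InnerProductSpace ℂ H] [CompleteSpace H]
  {π : A →⋆ₐ[ℂ] (H →L[ℂ] H)}
  {K : Type*} [NormedAddCommGroup K] [InnerProductSpace ℂ K] [CompleteSpace K]
  {ρ : crossedProduct π₀ θ →⋆ₐ[ℂ] (K →L[ℂ] K)}

/-- The approximation of the crossed product obtained from one of `A`: compress to `m × m` matrices
over `A`, approximate entrywise, and average back. -/
def CPA.induce (hπ₀ : Function.Injective π₀) {m : ℕ} [NeZero m] {ε : ℝ} {T : Set A}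
    (f : CPA π T (ε / (4 * m)))
    {Φ : (H →L[ℂ] H) →ₗ[ℂ] (K →L[ℂ] K)} (hΦ : IsUCP Φ)
    (hΦρ : ∀ x, Φ (π x) = ρ (inclusion π₀ θ x)) {S : Set (crossedProduct π₀ θ)}
    (hST : ∀ p q : Fin m, Set.MapsTo (coeff θ hπ₀ p q) S T)
    (hS : ∀ z ∈ S, ‖fejerMean ρ hπ₀ m z - ρ z‖ < ε / 2) : CPA ρ S ε where
  B := CStarMatrix (Fin m) (Fin m) f.B
  φ := CStarMatrix.mapₗ f.φ ∘ₗ coeffMatrix θ hπ₀ m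
  ψ := average (implementingUnitary ρ) m ∘ₗ CStarMatrix.mapₗ (Φ ∘ₗ f.ψ)
  Tr := matTrace (Fin m) f.Tr
  isUCP_φ := f.isUCP_φ.mapₗ.comp (isUCP_coeffMatrix θ hπ₀ m)
  isUCP_ψ := (isUCP_average _ m).comp (hΦ.comp f.isUCP_ψ).mapₗ
  isCanonicalTrace := f.isCanonicalTrace.matTrace
  approx z hz := by
    set W := implementingUnitary ρ
    set M := CStarMatrix.mapₗ (Φ ∘ₗ f.ψ ∘ₗ f.φ) (coeffMatrix θ hπ₀ m z)
    set N := CStarMatrix.mapₗ (ρ.toLinearMap ∘ₗ (inclusion π₀ θ).toLinearMap)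
      (coeffMatrix θ hπ₀ m z)
    have entry_le (p q : Fin m) : ‖(M - N) p q‖ ≤ 2 * (ε / (4 * m)) := by
      change ‖Φ (f.ψ (f.φ (coeff θ hπ₀ p q z))) - ρ (inclusion π₀ θ (coeff θ hπ₀ p q z))‖ ≤ _
      rw [← hΦρ, ← map_sub]
      refine (hΦ.norm_le _).trans ?_
      gcongr
      exact (f.approx _ (hST p q hz)).le
    have average_le : ‖average W m M - fejerMean ρ hπ₀ m z‖ ≤ ε / 2 := by
      refine (congrArg norm (map_sub (average W m) M N)).symm.trans_le
        ((norm_average_le W entry_le).trans_eq ?_)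
      field_simp [NeZero.ne (m : ℝ)]
      ring
    calc ‖average W m M - ρ z‖
        ≤ ‖average W m M - fejerMean ρ hπ₀ m z‖ + ‖fejerMean ρ hπ₀ m z - ρ z‖ :=
          norm_sub_le_norm_sub_add_norm_sub _ _ _
      _ < ε / 2 + ε / 2 := add_lt_add_of_le_of_lt average_le (hS z hz)
      _ = ε := add_halves ε

theorem exists_norm_fejerMean_sub_lt (hπ₀ : Function.Injective π₀)
    (Ω : Finset (crossedProduct π₀ θ)) {ε : ℝ} (hε : 0 < ε) :
    ∃ m : ℕ, ∀ z ∈ Ω, ‖fejerMean ρ hπ₀ (m + 1) z - ρ z‖ < ε := by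
  have eventually_lt : ∀ᶠ m in Filter.atTop, ∀ z ∈ Ω, ‖fejerMean ρ hπ₀ (m + 1) z - ρ z‖ < ε :=
    Ω.eventually_all.2 fun z _ => by
      simpa only [dist_eq_norm] using Metric.tendsto_nhds.1 (tendsto_fejerMean ρ hπ₀ z) ε hε
  exact eventually_lt.exists

theorem pressure_adUnitary_le (hπ₀ : Function.Injective π₀) (hπ : Function.Injective π) {a : A}
    (ha : IsSelfAdjoint a) :
    pressure ρ (adUnitary π₀ θ) (inclusion π₀ θ a) ≤ pressure π θ a := by
  classical
  obtain ⟨Φ, hΦ, hΦρ⟩ := exists_ucp_extension (ρ.comp (inclusion π₀ θ)) π hπ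
  refine pressure_le_of_forall_exists_CPA fun Ω ε hε => ?_
  obtain ⟨k, hk⟩ := exists_norm_fejerMean_sub_lt (ρ := ρ) hπ₀ Ω (half_pos hε)
  set m := k + 1
  let Λ := Finset.univ.biUnion fun p : Fin m × Fin m => Ω.image (coeff θ hπ₀ p.1 p.2)
  have mapsTo (p q : Fin m) : Set.MapsTo (coeff θ hπ₀ p q) Ω Λ := fun z hz =>
    Finset.mem_biUnion.2 ⟨(p, q), Finset.mem_univ _, Finset.mem_image_of_mem _ hz⟩
  refine ⟨Λ, ε / (4 * m), by positivity, m * Real.exp (m * (2 * ‖a‖)), by positivity,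
    fun n f => ?_⟩
  have approx : ∀ z ∈ orbitSet (adUnitary π₀ θ) Ω n, ‖fejerMean ρ hπ₀ m z - ρ z‖ < ε / 2 :=
    forall_mem_orbitSet.2 fun j _ z hz => by
      rw [norm_fejerMean_iterate_sub]
      exact hk z hz
  refine ⟨f.induce hπ₀ hΦ hΦρ
    (fun p q => mapsTo_orbitSet (semiconj_coeff θ hπ₀ p q) (mapsTo p q) n) approx, ?_⟩
  rw [← map_orbitSum fun x => (adUnitary_inclusion π₀ θ x).symm]
  refine re_matTrace_exp_le θ f.isCanonicalTrace f.isUCP_φ hπ₀ (isSelfAdjoint_orbitSum θ ha n)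
    fun p => (norm_zpow_neg_sub_le θ _ p).trans ?_
  gcongr
  · exact p.2.le
  · exact norm_map_orbitSum_sub_le θ a n

theorem theorem5p5_general (hπ₀ : Function.Injective π₀) (hπ : Function.Injective π)
    (hρ : Function.Injective ρ) {a : A} (ha : IsSelfAdjoint a) :
    pressure π θ a = pressure ρ (adUnitary π₀ θ) (inclusion π₀ θ a) :=
  le_antisymm
    (pressure_le_pressure_map (inclusion_injective θ hπ₀)
      (fun x => (adUnitary_inclusion π₀ θ x).symm) hρ a)
    (pressure_adUnitary_le hπ₀ hπ ha)

end CrossedProduct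

end CStarPressure

end

theorem theorem5p5 {A : Type*} [CStarAlgebra A] (hA : CStarPressure.IsExact A)
    (θ : A ≃⋆ₐ[ℂ] A) (a : A) (ha : IsSelfAdjoint a)
    -- a faithful unital representation used to form the crossed product
    {H₀ : Type*} [NormedAddCommGroup H₀] [InnerProductSpace ℂ H₀] [CompleteSpace H₀]
    (π₀ : A →⋆ₐ[ℂ] (H₀ →L[ℂ] H₀)) (hπ₀ : Function.Injective π₀)
    -- faithful unital representations used to compute the two pressures
    {H : Type*} [NormedAddCommGroup H] [InnerProductSpace ℂ H] [CompleteSpace H]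
    (π : A →⋆ₐ[ℂ] (H →L[ℂ] H)) (hπ : Function.Injective π)
    {K : Type*} [NormedAddCommGroup K] [InnerProductSpace ℂ K] [CompleteSpace K]
    (ρ : CStarPressure.crossedProduct π₀ θ →⋆ₐ[ℂ] (K →L[ℂ] K)) (hρ : Function.Injective ρ) :
    CStarPressure.pressure π θ a =
      CStarPressure.pressure ρ (CStarPressure.adUnitary π₀ θ)
        (CStarPressure.inclusion π₀ θ a) :=
  CStarPressure.theorem5p5_general hπ₀ hπ hρ ha
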